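/- Let $\mathsf{AP}$ be a finite set of atomic propositions. A plant $\mathcal P=\langle S,s_{\mathit{init}},\mathfrak c,\mathfrak u,L\rangle$ consists of a finite set $S$ of states, an initial state $s_{\mathit{init}}\in S$, disjoint sets $\mathfrak c,\mathfrak u\subseteq S\times S$ of controllable and uncontrollable transitions such that every state has at least one outgoing transition in $\mathfrak c\cup\mathfrak u$, and a labeling $L:S\to 2^{\mathsf{AP}}$. Its size is its number of states. It is tree-shaped if the directed graph $\langle S,\mathfrak c\cup\mathfrak u\rangle$ is a rooted tree with edges directed away from the root, except that every leaf additionally has a self-loop (and no other outgoing transition). The traces of $\mathcal P$ are the label sequences of the infinite paths from $s_{\mathit{init}}$, and $\mathcal P\models\varphi$ means that the set of traces of $\mathcal P$ satisfies the HyperLTL sentence $\varphi$. The controller synthesis problem for $\mathcal P$ and $\varphi$ asks whether there is a plant $\mathcal P'=\langle S,s_{\mathit{init}},\mathfrak c',\mathfrak u,L\rangle$ with $\mathfrak c'\subseteq\mathfrak c$ (so every state of $\mathcal P'$ still has an outgoing transition) and $\mathcal P'\models\varphi$. Theorem. For every finite set $\mathsf{AP}$ and every fixed closed HyperLTL formula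 $\varphi$ over $\mathsf{AP}$ (with an arbitrary quantifier prefix), the controller synthesis problem for $\varphi$, restricted to tree-shaped plants, is in $\mathsf{NP}$ in the size of the plant; that is, the language of the standard binary encodings (number of states in unary, transition relations as adjacency matrices, labels as bit vectors), of length polynomially related to the number of states, of those tree-shaped plants $\mathcal P$ for which the answer is affirmative belongs to $\mathsf{NP}$. -/

import Mathlib

/-! ## Plants -/

/-- A trace over the alphabet of subsets of `AP`: an infinite sequence of letters. -/
abbrev Trace (AP : Type*) := ℕ → Set AP

/-- A plant with states `S`: an initial state, disjoint sets of controllable and uncontrollable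
transitions, and a labeling of the states. Every state has an outgoing transition. -/
@[ext]
structure Plant (AP S : Type*) where
  init : S
  ctrl : S → S → Prop
  unctrl : S → S → Prop
  label : S → Set AP
  disjoint : ∀ s t, ¬ (ctrl s t ∧ unctrl s t)
  total : ∀ s, ∃ t, ctrl s t ∨ unctrl s t

namespace Plant

variable {AP S : Type*}

/-- The transition relation of the frame of a plant: all transitions. -/
def Edge (P : Plant AP S) (s t : S) : Prop := P.ctrl s t ∨ P.unctrl s t

/-- A path: an infinite sequence of states that starts in the initial state and follows the
transitions. -/
def IsPath (P : Plant AP S) (p : ℕ → S) : Prop :=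
  p 0 = P.init ∧ ∀ i, P.Edge (p i) (p (i + 1))

/-- The set of traces of a plant. -/
def traces (P : Plant AP S) : Set (Trace AP) :=
  {t | ∃ p, P.IsPath p ∧ ∀ i, t i = P.label (p i)}

/-- The frame is a tree: there is a root, from which every state is reachable; the root has no
predecessor and every other state has exactly one predecessor, where self-loops are disregarded;
and a state with a self-loop has no other outgoing transition, that is, it is a leaf. (A leaf does
have a self-loop, because every state has an outgoing transition.) -/
def TreeShaped (P : Plant AP S) : Prop :=
  ∃ root : S,
    (∀ s, Relation.ReflTransGen P.Edge root s) ∧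
    (∀ s, P.Edge s root → s = root) ∧
    (∀ s, s ≠ root → ∃! s', s' ≠ s ∧ P.Edge s' s) ∧
    (∀ s t, P.Edge s s → P.Edge s t → t = s)

end Plant

/-! ## HyperLTL -/

/-- Quantifier-free formulas. Trace variables are natural numbers, and `atom a x` is the atomic
proposition `a` indexed by the trace variable `x`. -/
inductive LTLBody (AP : Type*) where
  | tt : LTLBody AP
  | atom (a : AP) (x : ℕ) : LTLBody AP
  | neg (ψ : LTLBody AP) : LTLBody AP
  | or (ψ₁ ψ₂ : LTLBody AP) : LTLBody AP
  | untl (ψ₁ ψ₂ : LTLBody AP) : LTLBody AP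
  | next (ψ : LTLBody AP) : LTLBody AP

/-- HyperLTL formulas: a prefix of trace quantifiers in front of a quantifier-free formula. -/
inductive HyperLTL (AP : Type*) where
  | ex (x : ℕ) (φ : HyperLTL AP) : HyperLTL AP
  | all (x : ℕ) (φ : HyperLTL AP) : HyperLTL AP
  | body (ψ : LTLBody AP) : HyperLTL AP

/-- Trace assignments: partial maps from trace variables to traces. -/
abbrev TraceAssignment (AP : Type*) := ℕ → Option (Trace AP)

/-- The assignment that maps every `x` in the domain to the suffix of its trace from `j` on. -/
def TraceAssignment.suffix {AP : Type*} (A : TraceAssignment AP) (j : ℕ) : TraceAssignment AP :=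
  fun x => (A x).map fun t i => t (j + i)

namespace LTLBody

variable {AP : Type*}

/-- The trace variables that occur in a quantifier-free formula. -/
def vars : LTLBody AP → Set ℕ
  | tt => ∅
  | atom _ x => {x}
  | neg ψ => ψ.vars
  | or ψ₁ ψ₂ => ψ₁.vars ∪ ψ₂.vars
  | untl ψ₁ ψ₂ => ψ₁.vars ∪ ψ₂.vars
  | next ψ => ψ.vars

/-- Satisfaction of a quantifier-free formula. -/
def Sat : LTLBody AP → TraceAssignment AP → Prop
  | tt, _ => True
  | atom a x, A => ∃ t, A x = some t ∧ a ∈ t 0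
  | neg ψ, A => ¬ ψ.Sat A
  | or ψ₁ ψ₂, A => ψ₁.Sat A ∨ ψ₂.Sat A
  | untl ψ₁ ψ₂, A => ∃ i, ψ₂.Sat (A.suffix i) ∧ ∀ j < i, ψ₁.Sat (A.suffix j)
  | next ψ, A => ψ.Sat (A.suffix 1)

end LTLBody

namespace HyperLTL

variable {AP : Type*}

/-- The free trace variables of a formula. -/
def freeVars : HyperLTL AP → Set ℕ
  | ex x φ => φ.freeVars \ {x}
  | all x φ => φ.freeVars \ {x}
  | body ψ => ψ.vars

/-- A formula is closed if it has no free trace variables. -/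
def Closed (φ : HyperLTL AP) : Prop := φ.freeVars = ∅

/-- Satisfaction of a formula over a set `T` of traces and a trace assignment. -/
def Sat (T : Set (Trace AP)) : HyperLTL AP → TraceAssignment AP → Prop
  | ex x φ, A => ∃ t ∈ T, φ.Sat T (Function.update A x (some t))
  | all x φ, A => ∀ t ∈ T, φ.Sat T (Function.update A x (some t))
  | body ψ, A => ψ.Sat A

end HyperLTL

/-! ## Controller synthesis -/

namespace Plant

variable {AP S : Type*}

/-- The set of traces of the plant satisfies the formula, from the assignment with empty domain. -/
def Models (P : Plant AP S) (φ : HyperLTL AP) : Prop :=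
  φ.Sat P.traces fun _ => none

/-- The controller synthesis problem: some plant that differs from `P` only in that controllable
transitions were removed satisfies `φ`. -/
def HasController (P : Plant AP S) (φ : HyperLTL AP) : Prop :=
  ∃ P' : Plant AP S,
    P'.init = P.init ∧
    (∀ s t, P'.ctrl s t → P.ctrl s t) ∧
    (∀ s t, P'.unctrl s t ↔ P.unctrl s t) ∧
    (∀ s, P'.label s = P.label s) ∧
    P'.Models φ

open Classical in
/-- The binary word that describes a plant with states `0, …, n - 1`, where `e` enumerates the
atomic propositions. It consists of `n` in unary, a separator, and one block for every state `s`: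
a bit that tells if `s` is the initial state, one bit for every atomic proposition that tells if
`s` carries it, and for every state `t` two bits that tell if `(s, t)` is a controllable and if it
is an uncontrollable transition. -/
noncomputable def encode {m n : ℕ} (e : Fin m ≃ AP) (P : Plant AP (Fin n)) : List Bool :=
  List.replicate n true ++ false :: (List.finRange n).flatMap fun s =>
    decide (s = P.init) :: ((List.finRange m).map fun a => decide (e a ∈ P.label s)) ++
      (List.finRange n).flatMap fun t => [decide (P.ctrl s t), decide (P.unctrl s t)]

/-- For a fixed set of atomic propositions, the length of the word that describes a plant and the
number of states of the plant are polynomially related. -/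
theorem length_encode {m n : ℕ} (e : Fin m ≃ AP) (P : Plant AP (Fin n)) :
    (P.encode e).length = n + 1 + n * (1 + m + 2 * n) := by
  simp [encode, List.length_flatMap, List.map_const', Nat.mul_comm]
  ring

end Plant

/-- Controller synthesis for tree-shaped plants and the formula `φ`, as a language: the words that
describe a tree-shaped plant for which the answer is affirmative. -/
def treeSynthesis {AP : Type*} {m : ℕ} (e : Fin m ≃ AP) (φ : HyperLTL AP) : Language Bool :=
  {w | ∃ (n : ℕ) (P : Plant AP (Fin n)), P.TreeShaped ∧ P.HasController φ ∧ w = P.encode e}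

/-! ## The class NP -/

/-- The word over the disjoint union of two alphabets that represents a pair of words. -/
def encodePair {Γ Δ : Type} (x : List Γ × List Δ) : List (Γ ⊕ Δ) :=
  x.1.map Sum.inl ++ x.2.map Sum.inr

/-- A language is in NP if membership of a word is witnessed by certificates of polynomial length
that a deterministic (multi-stack Turing) machine verifies in polynomial time. -/
def InNP (L : Language Bool) : Prop :=
  ∃ (V : List Bool × List Bool → Bool) (p : Polynomial ℕ),
    Nonempty (Turing.TM2ComputableInPolyTime encodePair Computability.encodeBool V) ∧
    ∀ w, w ∈ L ↔ ∃ c : List Bool, c.length ≤ p.eval w.length ∧ V (w, c) = true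

/-! A path of a tree-shaped plant with n states descends one level per step until it meets a
self-loop, where it stays; this happens by time n. As predecessors in a tree are unique, a path from
the initial state is determined by its state at time n. Removing transitions preserves both facts,
so a restriction has at most n traces, all constant from time n on. Hence trace quantifiers become
quantifiers over at most n rows of a table, and temporal operators become quantifiers over the times
0, …, n.

A certificate holds the kept transitions, the table of paths, and a strict order in which every
non-root state lies above its predecessor. The order replaces reachability from the root: on
finitely many states it is well founded, so following predecessors must end in the root. The table
is checked locally: rows are paths, and every one-step deviation from a prefix of a row is a prefix
of some row. By induction on the length, all paths then occur. The facts on paths are in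
`Plant.TreeShaped.paths`; `DescribedBy.mem_traces_iff` and `DescribedBy.isPathTable` show that path
tables capture the traces and exist; `LTLBody.holds_iff` and `HyperLTL.holds_iff` translate
satisfaction.

All checks are thus built by Boolean connectives and polynomially bounded number quantifiers from
comparisons and from bits of the input. For fixed φ their nesting is fixed, so exhaustive search
takes polynomial time. This is made precise by `Tm` and `FO`, with `FO.ex` as the central closure
property. The programs are structured programs on stacks holding unary numbers; `Runs.reachesIn`
compiles them to machines without loss of time. -/

/-! ## Structured stack programs -/

/-- The registers of a stack program: the last popped symbol and a flag. -/
abbrev Reg := Option Bool × Bool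

/-- The contents of the stacks of a stack program. -/
abbrev Store := ℕ → List Bool

/-- Structured programs that work on stacks of bits. -/
inductive StackProg where
  | push (k : ℕ) (f : Reg → Bool) : StackProg
  | pop (k : ℕ) : StackProg
  | load (f : Reg → Reg) : StackProg
  | seq (p q : StackProg) : StackProg
  | ite (c : Reg → Bool) (p q : StackProg) : StackProg
  | loop (c : Reg → Bool) (p : StackProg) : StackProg

namespace StackProg

/-- `Runs p x n y`: the program `p`, started in `x`, terminates in `y` after `n` steps. -/
inductive Runs : StackProg → Reg × Store → ℕ → Reg × Store → Prop
  | push (k f v s) : Runs (push k f) (v, s) 1 (v, Function.update s k (f v :: s k))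
  | pop (k v s) : Runs (pop k) (v, s) 1 (((s k).head?, v.2), Function.update s k (s k).tail)
  | load (f v s) : Runs (load f) (v, s) 1 (f v, s)
  | seq {p q x y z m n} : Runs p x m y → Runs q y n z → Runs (seq p q) x (m + n) z
  | ite_true {c p q v s n y} : c v = true → Runs p (v, s) n y → Runs (ite c p q) (v, s) (n + 1) y
  | ite_false {c p q v s n y} : c v = false → Runs q (v, s) n y → Runs (ite c p q) (v, s) (n + 1) y
  | loop_done {c p v s} : c v = false → Runs (loop c p) (v, s) 1 (v, s)
  | loop_step {c p v s y z m n} : c v = true → Runs p (v, s) m y → Runs (loop c p) y n z →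
      Runs (loop c p) (v, s) (m + n + 1) z

/-- A strict upper bound on the stacks that a program uses. -/
def bound : StackProg → ℕ
  | push k _ => k + 1
  | pop k => k + 1
  | load _ => 0
  | seq p q => max p.bound q.bound
  | ite _ p q => max p.bound q.bound
  | loop _ p => p.bound

/-- The labels of the machine for a program. -/
def Lbl : StackProg → Type
  | push _ _ => Unit
  | pop _ => Unit
  | load _ => Unit
  | seq p q => p.Lbl ⊕ q.Lbl
  | ite _ p q => Option (p.Lbl ⊕ q.Lbl)
  | loop _ p => Option p.Lbl

/-- There are finitely many labels. -/
@[reducible]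
def fintypeLbl : ∀ p : StackProg, Fintype p.Lbl
  | push _ _ => inferInstanceAs (Fintype Unit)
  | pop _ => inferInstanceAs (Fintype Unit)
  | load _ => inferInstanceAs (Fintype Unit)
  | seq p q => letI := p.fintypeLbl; letI := q.fintypeLbl; inferInstanceAs (Fintype (p.Lbl ⊕ q.Lbl))
  | ite _ p q =>
    letI := p.fintypeLbl; letI := q.fintypeLbl; inferInstanceAs (Fintype (Option (p.Lbl ⊕ q.Lbl)))
  | loop _ p => letI := p.fintypeLbl; inferInstanceAs (Fintype (Option p.Lbl))

/-- The label at which the execution of a program starts. -/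
def entry : ∀ p : StackProg, p.Lbl
  | push _ _ => ()
  | pop _ => ()
  | load _ => ()
  | seq p _ => Sum.inl p.entry
  | ite _ _ _ => none
  | loop _ _ => none

/-- The stack alphabets: the input stack `none` holds pairs of words, the others bits. -/
abbrev Alph (N : ℕ) : Option (Fin N) → Type
  | none => Bool ⊕ Bool
  | some _ => Bool

open Turing.TM2 in
/-- The code of a program, as part of a machine with labels `Λ`, that continues at `exit`. -/
def code (N : ℕ) [NeZero N] {Λ : Type} : ∀ p : StackProg, (p.Lbl → Λ) → Λ → p.Lbl →
    Stmt (Alph N) Λ Reg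
  | push k f, _, exit, _ => .push (some (Fin.ofNat N k)) f (.goto fun _ => exit)
  | pop k, _, exit, _ => .pop (some (Fin.ofNat N k)) (fun v b => (b, v.2)) (.goto fun _ => exit)
  | load f, _, exit, _ => .load f (.goto fun _ => exit)
  | seq p q, emb, exit, l => match l with
    | Sum.inl l => p.code N (fun l => emb (Sum.inl l)) (emb (Sum.inr q.entry)) l
    | Sum.inr l => q.code N (fun l => emb (Sum.inr l)) exit l
  | ite c p q, emb, exit, l => match l with
    | none => .branch c (.goto fun _ => emb (some (Sum.inl p.entry)))
        (.goto fun _ => emb (some (Sum.inr q.entry)))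
    | some (Sum.inl l) => p.code N (fun l => emb (some (Sum.inl l))) exit l
    | some (Sum.inr l) => q.code N (fun l => emb (some (Sum.inr l))) exit l
  | loop c p, emb, exit, l => match l with
    | none => .branch c (.goto fun _ => emb (some p.entry)) (.goto fun _ => exit)
    | some l => p.code N (fun l => emb (some l)) (emb none) l

/-- The stacks of the machine: the input stack and the first `N` stacks of the store. -/
def contents {N : ℕ} (i : List (Bool ⊕ Bool)) (s : Store) : ∀ k : Option (Fin N), List (Alph N k)
  | none => i
  | some k => s k

/-- The code reduces stack numbers modulo `N`. Below `N` this changes nothing, so distinct stacks of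
the store stay distinct in the machine. -/
theorem contents_update {N : ℕ} [NeZero N] (i : List (Bool ⊕ Bool)) (s : Store) {k : ℕ} (hk : k < N)
    (l : List Bool) : Function.update (contents (N := N) i s) (some (Fin.ofNat N k)) l =
      contents i (Function.update s k l) := by
  funext j
  rcases j with _ | j
  · rw [Function.update_of_ne (by simp)]; rfl
  · by_cases h : j = Fin.ofNat N k
    · subst h
      rw [Function.update_self]
      simp [contents, Nat.mod_eq_of_lt hk]
    · rw [Function.update_of_ne (by simpa using h)]
      have : (j : ℕ) ≠ k := by
        rintro rfl
        exact h (by ext; simp)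
      simp [contents, this]

theorem contents_some {N : ℕ} [NeZero N] (i : List (Bool ⊕ Bool)) (s : Store) {k : ℕ} (hk : k < N) :
    contents (N := N) i s (some (Fin.ofNat N k)) = s k := by
  simp [contents, Nat.mod_eq_of_lt hk]

/-! ### Simulation of stack programs by multi-stack machines -/

section Machine

variable {N : ℕ} {Λ : Type} (M : Λ → Turing.TM2.Stmt (Alph N) Λ Reg)

/-- Reachability of a configuration of the machine in exactly `n` steps. -/
def ReachesIn (n : ℕ) (x y : Turing.TM2.Cfg (Alph N) Λ Reg) : Prop :=
  (flip bind (Turing.TM2.step M))^[n] (some x) = some y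

variable {M}

theorem ReachesIn.trans {m n : ℕ} {x y z} (h₁ : ReachesIn M m x y) (h₂ : ReachesIn M n y z) :
    ReachesIn M (m + n) x z := by
  unfold ReachesIn at *
  rw [Nat.add_comm, Function.iterate_add_apply, h₁, h₂]

theorem ReachesIn.head {n : ℕ} {l : Λ} {v S z}
    (h : ReachesIn M n (Turing.TM2.stepAux (M l) v S) z) : ReachesIn M (n + 1) ⟨some l, v, S⟩ z := by
  unfold ReachesIn at *
  rw [Function.iterate_succ_apply]
  exact h

theorem ReachesIn.single {l : Λ} {v S z} (h : Turing.TM2.stepAux (M l) v S = z) :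
    ReachesIn M 1 ⟨some l, v, S⟩ z :=
  ReachesIn.head (n := 0) (congrArg some h)

/-- The compiled code of a program simulates the program. -/
theorem Runs.reachesIn [NeZero N] {p : StackProg} {x y : Reg × Store} {n : ℕ} (h : Runs p x n y)
    (hp : p.bound ≤ N) (i : List (Bool ⊕ Bool)) (emb : p.Lbl → Λ) (exit : Λ)
    (hM : ∀ l, M (emb l) = p.code N emb exit l) :
    ReachesIn M n ⟨some (emb p.entry), x.1, contents i x.2⟩ ⟨some exit, y.1, contents i y.2⟩ := by
  -- The rules of `Runs` count machine steps exactly. Sequencing costs nothing, because the exit of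
  -- the first program is the entry of the second; a test costs one step.
  induction h generalizing exit with
  | push k f v s =>
    apply ReachesIn.single
    rw [hM]
    simp only [code, Turing.TM2.stepAux]
    rw [contents_some i s hp]
    exact congrArg _ (contents_update i s hp _)
  | pop k v s =>
    apply ReachesIn.single
    rw [hM]
    simp only [code, Turing.TM2.stepAux]
    rw [contents_some i s hp]
    exact congrArg _ (contents_update i s hp _)
  | load f v s =>
    apply ReachesIn.single
    rw [hM]
    rfl
  | seq _ _ ih₁ ih₂ =>
    exact (ih₁ (le_trans (le_max_left _ _) hp) (fun l => emb (Sum.inl l)) _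
      (fun l => hM (Sum.inl l))).trans
      (ih₂ (le_trans (le_max_right _ _) hp) (fun l => emb (Sum.inr l)) _ (fun l => hM (Sum.inr l)))
  | ite_true hc _ ih =>
    apply ReachesIn.head
    rw [hM]
    simp only [code, entry, Turing.TM2.stepAux, hc, cond_true]
    exact ih (le_trans (le_max_left _ _) hp) (fun l => emb (some (Sum.inl l))) _
      (fun l => hM (some (Sum.inl l)))
  | ite_false hc _ ih =>
    apply ReachesIn.head
    rw [hM]
    simp only [code, entry, Turing.TM2.stepAux, hc, cond_false]
    exact ih (le_trans (le_max_right _ _) hp) (fun l => emb (some (Sum.inr l))) _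
      (fun l => hM (some (Sum.inr l)))
  | loop_done hc =>
    apply ReachesIn.single
    rw [hM]
    simp only [code, entry, Turing.TM2.stepAux, hc, cond_false]
  | loop_step hc _ _ ih₁ ih₂ =>
    apply ReachesIn.head
    rw [hM]
    simp only [code, entry, Turing.TM2.stepAux, hc, cond_true]
    exact (ih₁ hp (fun l => emb (some l)) _ (fun l => hM (some l))).trans (ih₂ hp emb _ hM)

end Machine

/-- The machine that splits its input, runs a program and outputs the flag. -/
def machine (N : ℕ) [NeZero N] (p : StackProg) : Turing.FinTM2 :=
  letI := p.fintypeLbl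
  { K := Option (Fin N)
    k₀ := none
    k₁ := some 0
    Γ := Alph N
    Λ := Option (Option p.Lbl)
    main := none
    σ := Reg
    initialState := (none, false)
    Γk₀Fin := inferInstanceAs (Fintype (Bool ⊕ Bool))
    m := fun
      -- The first register keeps the popped bit, the flag tells from which of the two words it
      -- comes.
      | none => .pop none (fun _ b => (b.map (Sum.elim id id : Bool ⊕ Bool → Bool),
            (b.map (Sum.elim (fun _ => false) (fun _ => true) : Bool ⊕ Bool → Bool)).getD false))
          (.branch (fun v => v.1.isSome)
            (.branch (fun v => v.2)
              (.push (some (Fin.ofNat N 4)) (fun v => v.1.getD false) (.goto fun _ => none))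
              (.push (some (Fin.ofNat N 3)) (fun v => v.1.getD false) (.goto fun _ => none)))
            (.goto fun _ => some (some p.entry)))
      -- The registers are reset because a halting configuration with output must have the initial
      -- registers.
      | some none => .push (some 0) (fun v => v.2) (.load (fun _ => (none, false)) .halt)
      | some (some l) => p.code N (fun l => some (some l)) (some none) l }

/-- The store with the given words on the stacks `3` and `4`. -/
def inputStore (x y : List Bool) : Store := fun k => if k = 3 then x else if k = 4 then y else []

theorem contents_tail {N : ℕ} (i : List (Bool ⊕ Bool)) (s : Store) :
    Function.update (contents (N := N) i s) none i.tail = contents i.tail s := by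
  funext j
  rcases j with _ | j
  · rfl
  · rw [Function.update_of_ne (by simp)]; rfl

theorem machine_split_step (N : ℕ) [NeZero N] (hN : 5 ≤ N) (p : StackProg) (b : Bool ⊕ Bool)
    (i : List (Bool ⊕ Bool)) (v : Reg) (s : Store) :
    Turing.TM2.stepAux ((machine N p).m none) v (contents (N := N) (b :: i) s) =
      ⟨some none, b.elim (fun b => (some b, false)) (fun b => (some b, true)),
        contents i (b.elim (fun b => Function.update s 3 (b :: s 3))
          (fun b => Function.update s 4 (b :: s 4)))⟩ := by
  have ht := contents_tail (N := N) (b :: i) s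
  rw [List.tail_cons] at ht
  have h3 := fun l => contents_update (N := N) i s (k := 3) (by omega) l
  have h4 := fun l => contents_update (N := N) i s (k := 4) (by omega) l
  have h3' := contents_some (N := N) i s (k := 3) (by omega)
  have h4' := contents_some (N := N) i s (k := 4) (by omega)
  change Turing.TM2.stepAux (Turing.TM2.Stmt.branch _ _ _) _
    (Function.update (contents (N := N) (b :: i) s) none i) = _
  rw [ht]
  rcases b with b | b
  · refine Eq.trans ?_ (congrArg _ (h3 _))
    rw [← h3']
    rfl
  · refine Eq.trans ?_ (congrArg _ (h4 _))
    rw [← h4']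
    rfl

theorem update_inputStore_three (x y l : List Bool) :
    Function.update (inputStore x y) 3 l = inputStore l y := by
  funext k; by_cases hk : k = 3 <;> simp [inputStore, hk]

theorem update_inputStore_four (x y l : List Bool) :
    Function.update (inputStore x y) 4 l = inputStore x l := by
  funext k; by_cases hk : k = 4 <;> simp [inputStore, hk]

/-- Moving a word from one stack to another reverses it. Each symbol costs one step, and one more
step detects that the input stack is empty. -/
theorem machine_split (N : ℕ) [NeZero N] (hN : 5 ≤ N) (p : StackProg)
    (w c : List Bool) (v : Reg) (x y : List Bool) :
    ReachesIn (N := N) (machine N p).m (w.length + c.length + 1)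
      ⟨some none, v, contents (w.map Sum.inl ++ c.map Sum.inr) (inputStore x y)⟩
      ⟨some (some (some p.entry)), (none, false),
        contents [] (inputStore (w.reverse ++ x) (c.reverse ++ y))⟩ := by
  induction w generalizing v x with
  | nil =>
    induction c generalizing v y with
    | nil => exact ReachesIn.single (congrArg _ (contents_tail (N := N) [] (inputStore x y)))
    | cons b c ih =>
      rw [List.length_cons, ← Nat.add_assoc, Nat.add_right_comm _ 1 1]
      apply ReachesIn.head
      have h := ih (b :: y) (some b, true)
      rw [← update_inputStore_four x y] at h
      simp only [List.reverse_cons, List.append_assoc, List.singleton_append]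
      refine Eq.trans (congrArg _ (congrArg some ?_)) h
      exact machine_split_step N hN p (Sum.inr b) _ v _
  | cons b w ih =>
    rw [List.length_cons, Nat.add_right_comm _ 1, Nat.add_right_comm _ 1 1]
    apply ReachesIn.head
    have h := ih (some b, false) (b :: x)
    rw [← update_inputStore_three x y] at h
    simp only [List.reverse_cons, List.append_assoc, List.singleton_append]
    refine Eq.trans (congrArg _ (congrArg some ?_)) h
    exact machine_split_step N hN p (Sum.inl b) _ v _

/-- A program that decides a predicate of pairs of words yields a machine that does so. -/
theorem nonempty_polyTime (p : StackProg) (T : Polynomial ℕ)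
    (V : List Bool × List Bool → Bool)
    (h : ∀ w c, ∃ n ≤ T.eval (w.length + c.length), ∃ r,
      Runs p ((none, false), inputStore w.reverse c.reverse) n ((r, V (w, c)), fun _ => [])) :
    Nonempty (Turing.TM2ComputableInPolyTime encodePair Computability.encodeBool V) := by
  obtain ⟨N, hN, hp⟩ : ∃ N, 5 ≤ N ∧ p.bound ≤ N := ⟨_, le_max_left _ _, le_max_right _ _⟩
  have : NeZero N := ⟨by omega⟩
  refine ⟨{ tm := machine N p
            inputAlphabet := Equiv.refl (Bool ⊕ Bool)
            outputAlphabet := Equiv.refl Bool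
            -- Splitting the input, running the program, writing the answer.
            time := Polynomial.X + 1 + T + 1
            outputsFun := fun x => Classical.choice ?_ }⟩
  obtain ⟨w, c⟩ := x
  obtain ⟨n, hn, r, hr⟩ := h w c
  have h₁ := machine_split N hN p w c (none, false) [] []
  rw [List.append_nil, List.append_nil] at h₁
  have h₂ := hr.reachesIn (M := (machine N p).m) hp [] (fun l => some (some l)) (some none)
    (fun l => rfl)
  have h₃ : ReachesIn (N := N) (machine N p).m 1
      ⟨some (some none), (r, V (w, c)), contents [] fun _ => []⟩
      ⟨none, (none, false), contents [] (Function.update (fun _ => []) 0 [V (w, c)])⟩ :=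
    ReachesIn.single (congrArg _ (contents_update [] (fun _ => []) (k := 0) (by omega) [V (w, c)]))
  have h₄ := (h₁.trans h₂).trans h₃
  have hlen : (encodePair (w, c)).length = w.length + c.length := by simp [encodePair]
  refine ⟨⟨⟨w.length + c.length + 1 + n + 1, ?_⟩, ?_⟩⟩
  · refine Eq.trans (congrArg _ (congrArg some ?_)) (Eq.trans h₄ (congrArg some ?_))
    · refine congrArg (Turing.TM2.Cfg.mk _ _) ?_
      funext k
      rcases k with _ | k
      · change List.map id (encodePair (w, c)) = _
        rw [List.map_id]; rfl
      · change [] = inputStore [] [] k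
        simp [inputStore]
    · refine congrArg (Turing.TM2.Cfg.mk _ _) ?_
      funext k
      rcases k with _ | k
      · rfl
      · by_cases hk : k = 0
        · subst hk
          rfl
        · have h₀ : (some k : Option (Fin N)) ≠ some 0 := by simpa using hk
          refine Eq.trans ?_ (dif_neg h₀).symm
          have h₁ : (k : ℕ) ≠ 0 := fun h => hk (Fin.ext h)
          simp [contents, h₁]
          rfl
  · simp [hlen]; omega

end StackProg

/-! ### Time-bounded execution and basic programs -/

namespace StackProg

/-- The program `p` terminates in at most `T` steps. -/
def RunsIn (T : ℕ) (p : StackProg) (x y : Reg × Store) : Prop := ∃ n ≤ T, Runs p x n y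

theorem RunsIn.mono {T T' : ℕ} {p x y} (h : RunsIn T p x y) (hT : T ≤ T') : RunsIn T' p x y :=
  let ⟨n, hn, hr⟩ := h
  ⟨n, hn.trans hT, hr⟩

theorem RunsIn.seq {T T' : ℕ} {p q x y z} (h : RunsIn T p x y) (h' : RunsIn T' q y z) :
    RunsIn (T + T') (seq p q) x z :=
  let ⟨_, hn, hr⟩ := h
  let ⟨_, hn', hr'⟩ := h'
  ⟨_, Nat.add_le_add hn hn', hr.seq hr'⟩

theorem runsIn_push (k f v s) : RunsIn 1 (push k f) (v, s) (v, Function.update s k (f v :: s k)) :=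
  ⟨1, le_rfl, .push ..⟩

theorem runsIn_pop (k v s) :
    RunsIn 1 (pop k) (v, s) (((s k).head?, v.2), Function.update s k (s k).tail) :=
  ⟨1, le_rfl, .pop ..⟩

theorem runsIn_load (f v s) : RunsIn 1 (load f) (v, s) (f v, s) := ⟨1, le_rfl, .load ..⟩

theorem RunsIn.ite_true {c p q v s T y} (hc : c v = true) (h : RunsIn T p (v, s) y) :
    RunsIn (T + 1) (ite c p q) (v, s) y :=
  let ⟨_, hn, hr⟩ := h
  ⟨_, Nat.add_le_add_right hn 1, .ite_true hc hr⟩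

theorem RunsIn.ite_false {c p q v s T y} (hc : c v = false) (h : RunsIn T q (v, s) y) :
    RunsIn (T + 1) (ite c p q) (v, s) y :=
  let ⟨_, hn, hr⟩ := h
  ⟨_, Nat.add_le_add_right hn 1, .ite_false hc hr⟩

/-- Pop the stack `k` until it is empty and run `p` after each successful pop. -/
def forPop (k : ℕ) (p : StackProg) : StackProg :=
  seq (pop k) (loop (fun v => v.1.isSome) (seq p (pop k)))

/-- The loop is entered just after a pop, whereas `Q` speaks of the store before it. The body may
change stack `k` as long as it does not grow beyond the rest `l`; in particular it may clear it to
leave the loop early. -/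
theorem runsIn_loop_pop {k : ℕ} {p : StackProg} {T : ℕ} (Q : Bool → Store → Prop)
    (h : ∀ b l f s, s k = b :: l → Q f s → ∃ v' s', RunsIn T p ((some b, f), Function.update s k l)
      (v', s') ∧ (s' k).length ≤ l.length ∧ Q v'.2 s') (m : ℕ) :
    ∀ f s, (s k).length ≤ m → Q f s → ∃ v' s',
      RunsIn ((T + 3) * m + 1) (loop (fun v => v.1.isSome) (seq p (pop k)))
        (((s k).head?, f), Function.update s k (s k).tail) (v', s') ∧ s' k = [] ∧ Q v'.2 s' := by
  induction m with
  | zero =>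
    intro f s hs hQ
    have hk : s k = [] := List.eq_nil_of_length_eq_zero (Nat.le_zero.mp hs)
    refine ⟨(none, f), s, ⟨1, by simp, ?_⟩, hk, hQ⟩
    simp only [hk, List.head?_nil, List.tail_nil]
    rw [← hk, Function.update_eq_self]
    exact .loop_done rfl
  | succ m ih =>
    intro f s hs hQ
    rcases hk : s k with _ | ⟨b, l⟩
    · refine ⟨(none, f), s, ⟨1, by simp, ?_⟩, hk, hQ⟩
      simp only [List.head?_nil, List.tail_nil]
      rw [← hk, Function.update_eq_self]
      exact .loop_done rfl
    · obtain ⟨v', s', ⟨n, hn, hr⟩, hl, hQ'⟩ := h b l f s hk hQ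
      rw [hk, List.length_cons, Nat.add_le_add_iff_right] at hs
      obtain ⟨v'', s'', ⟨n', hn', hr'⟩, hk'', hQ''⟩ := ih v'.2 s' (hl.trans hs) hQ'
      refine ⟨v'', s'', ⟨(n + 1) + n' + 1, ?_, ?_⟩, hk'', hQ''⟩
      · rw [Nat.mul_succ]; omega
      · exact .loop_step rfl (hr.seq (.pop ..)) hr'

/-- The invariant rule for `forPop`. -/
theorem runsIn_forPop {k : ℕ} {p : StackProg} {T : ℕ} (Q : Bool → Store → Prop)
    (h : ∀ b l f s, s k = b :: l → Q f s → ∃ v' s', RunsIn T p ((some b, f), Function.update s k l)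
      (v', s') ∧ (s' k).length ≤ l.length ∧ Q v'.2 s') (v : Reg) (s : Store) (hQ : Q v.2 s) :
    ∃ v' s', RunsIn ((T + 3) * (s k).length + 2) (forPop k p) (v, s) (v', s') ∧ s' k = [] ∧
      Q v'.2 s' := by
  obtain ⟨v', s', hr, h'⟩ := runsIn_loop_pop Q h _ v.2 s le_rfl hQ
  exact ⟨v', s', ((runsIn_pop k v s).seq hr).mono (by omega), h'⟩

/-- The rule for `forPop` when the loop is controlled by a counter. -/
theorem runsIn_forPop_replicate {k : ℕ} {p : StackProg} {T t : ℕ} (S : ℕ → Store)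
    (h : ∀ i < t, ∀ v, ∃ v', RunsIn T p (v, Function.update (S i) k (List.replicate (t - i - 1) true))
      (v', Function.update (S (i + 1)) k (List.replicate (t - i - 1) true))) (v : Reg) :
    ∃ v', RunsIn ((T + 3) * t + 2) (forPop k p)
      (v, Function.update (S 0) k (List.replicate t true)) (v', Function.update (S t) k []) := by
  obtain ⟨v', s', hr, hk, i, hi, rfl⟩ := runsIn_forPop (k := k) (p := p) (T := T)
    (fun _ s' => ∃ i ≤ t, s' = Function.update (S i) k (List.replicate (t - i) true))
    (fun b l f s' hl ⟨i, hi, hs'⟩ => by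
      subst hs'
      rw [Function.update_self] at hl
      have hlt : i < t := by
        by_contra hlt
        rw [Nat.sub_eq_zero_of_le (by omega)] at hl
        simp at hl
      have hlen : l.length = t - i - 1 := by
        have := congrArg List.length hl
        simp at this
        omega
      have hll : l = List.replicate (t - i - 1) true := by
        rw [show t - i = t - i - 1 + 1 by omega, List.replicate_succ, List.cons_eq_cons] at hl
        exact hl.2.symm
      obtain ⟨v', hr⟩ := h i hlt (some b, f)
      refine ⟨v', _, ?_, ?_, i + 1, hlt, rfl⟩
      · rw [Function.update_idem, hll]
        exact hr
      · rw [Function.update_self, List.length_replicate, hlen]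
        omega) v (Function.update (S 0) k (List.replicate t true)) ⟨0, Nat.zero_le _, rfl⟩
  rw [Function.update_self] at hk
  have ht : i = t := by
    have := congrArg List.length hk
    simp at this
    omega
  subst ht
  simp only [Function.update_self, List.length_replicate] at hr
  rw [Nat.sub_self] at hr
  exact ⟨v', hr⟩

/-- The program that does nothing. -/
def skip : StackProg := load id

/-- Empty the stack `k`. -/
def clear (k : ℕ) : StackProg := forPop k skip

theorem runsIn_clear (k : ℕ) (v : Reg) (s : Store) :
    ∃ v', RunsIn (4 * (s k).length + 2) (clear k) (v, s) (v', Function.update s k []) ∧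
      v'.2 = v.2 := by
  obtain ⟨v', s', hr, hk, hf, hs⟩ := runsIn_forPop (k := k) (p := skip) (T := 1)
    (fun f s' => f = v.2 ∧ ∀ i ≠ k, s' i = s i)
    (fun b l f s' hl hQ => ⟨_, _, runsIn_load _ _ _, by simp, hQ.1, fun i hi => by
      rw [Function.update_of_ne hi, hQ.2 i hi]⟩) v s ⟨rfl, fun _ _ => rfl⟩
  refine ⟨v', ?_, hf⟩
  have : s' = Function.update s k [] := by
    funext i
    by_cases hi : i = k
    · subst hi; simp [hk]
    · simp [hi, hs i hi]
  exact this ▸ hr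

/-- Move the contents of the stack `j` to the stack `k`, which reverses them. -/
def move (j k : ℕ) : StackProg := forPop j (push k fun v => v.1.getD false)

theorem runsIn_move {j k : ℕ} (hjk : j ≠ k) (v : Reg) (s : Store) :
    ∃ v', RunsIn (4 * (s j).length + 2) (move j k) (v, s)
      (v', Function.update (Function.update s j []) k ((s j).reverse ++ s k)) ∧ v'.2 = v.2 := by
  obtain ⟨v', s', hr, hk, hf, hs, hs'⟩ := runsIn_forPop (k := j)
    (p := push k fun v => v.1.getD false) (T := 1)
    (fun f s' => f = v.2 ∧ (∀ i, i ≠ j → i ≠ k → s' i = s i) ∧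
      (s' j).reverse ++ s' k = (s j).reverse ++ s k)
    (fun b l f s' hl hQ => by
      refine ⟨_, _, runsIn_push _ _ _ _, ?_, hQ.1, fun i hi hi' => ?_, ?_⟩
      · simp [hjk]
      · simp [hi, hi', hQ.2.1 i hi hi']
      · have := hQ.2.2
        rw [hl] at this
        simp [hjk, hjk.symm] at this ⊢
        exact this) v s ⟨rfl, fun _ _ _ => rfl, rfl⟩
  refine ⟨v', ?_, hf⟩
  rw [hk] at hs'
  have : s' = Function.update (Function.update s j []) k ((s j).reverse ++ s k) := by
    funext i
    by_cases hi : i = k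
    · subst hi; simpa using hs'
    · by_cases hi' : i = j
      · subst hi'; simp [hk, hi]
      · simp [hi, hi', hs i hi' hi]
  exact this ▸ hr

/-- Push as many units on the stack `d` as the stack `i` has elements. -/
def pushLength (i d : ℕ) : StackProg :=
  seq (forPop i (seq (push 0 fun v => v.1.getD false) (push d fun _ => true))) (move 0 i)

/-- Stack `0` serves as a buffer: the elements of `i` pass through it while being counted on `d`,
and moving them back restores their order. -/
theorem runsIn_pushLength {i d : ℕ} (hi : i ≠ 0) (hd : d ≠ 0) (hid : i ≠ d) (v : Reg) (s : Store)
    (h₀ : s 0 = []) :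
    ∃ v', RunsIn (9 * (s i).length + 4) (pushLength i d) (v, s)
      (v', Function.update s d (List.replicate (s i).length true ++ s d)) := by
  obtain ⟨v', s', hr, hk, hs, hs', r, hsr, hr'⟩ := runsIn_forPop (k := i)
    (p := seq (push 0 fun v => v.1.getD false) (push d fun _ => true)) (T := 2)
    (fun _ s' => (∀ x, x ≠ i → x ≠ 0 → x ≠ d → s' x = s x) ∧
      (s' i).reverse ++ s' 0 = (s i).reverse ∧
      ∃ r, s' d = List.replicate r true ++ s d ∧ r + (s' i).length = (s i).length)
    (fun b l f s' hl ⟨hs, hs', r, hr, hr'⟩ => by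
      refine ⟨_, _, (runsIn_push _ _ _ _).seq (runsIn_push _ _ _ _), ?_, fun x hx hx' hx'' => ?_,
        ?_, r + 1, ?_, ?_⟩
      · simp [hi, hid]
      · simp [hx, hx', hx'', hs x hx hx' hx'']
      · rw [hl] at hs'
        simp [hi, hi.symm, hd, hd.symm, hid] at hs' ⊢
        exact hs'
      · simp [hd, hid.symm, hr, List.replicate_succ]
      · rw [hl] at hr'
        simp [hi, hid] at hr' ⊢
        omega) v s ⟨fun _ _ _ _ => rfl, by simp [h₀], 0, by simp, by simp⟩
  obtain ⟨v'', hm, -⟩ := runsIn_move (j := 0) (k := i) hi.symm v' s'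
  refine ⟨v'', ?_⟩
  rw [hk] at hs' hr'
  have hs₀ : s' 0 = (s i).reverse := hs'
  rw [hs₀, List.reverse_reverse, hk, List.append_nil, List.length_reverse] at hm
  have e : Function.update (Function.update s' 0 []) i (s i) =
      Function.update s d (List.replicate (s i).length true ++ s d) := by
    funext x
    by_cases hx : x = i
    · subst hx; simp [hid]
    · by_cases hx' : x = 0
      · subst hx'; simp [hx, hd.symm, h₀]
      · by_cases hx'' : x = d
        · subst hx''
          have : r = (s i).length := by simpa using hr'
          simp [hx, hx', hsr, this]
        · simp [hx, hx', hx'', hs x hx hx' hx'']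
  rw [e] at hm
  exact (hr.seq hm).mono (by omega)

/-- Pop the stack `k`, and save the popped bit, if any, on the stack `0`. -/
def popSave (k : ℕ) : StackProg :=
  seq (pop k) (ite (fun v => v.1.isSome) (push 0 fun v => v.1.getD false) skip)

/-- The store in which the first `n` bits of `w` have moved from the stack `k` to the stack `0`. -/
def savedStore (s : Store) (k : ℕ) (w : List Bool) (n : ℕ) : Store :=
  Function.update (Function.update s 0 (w.take n).reverse) k (w.drop n)

/-- Also valid past the end of `w`: nothing is saved then, and `take` and `drop` no longer change.
So moving stack `0` back restores `w` after any number of pops. -/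
theorem runsIn_popSave {k : ℕ} (hk : k ≠ 0) (v : Reg) (s : Store) (w : List Bool) (n : ℕ) :
    RunsIn 3 (popSave k) (v, savedStore s k w n) ((w[n]?, v.2), savedStore s k w (n + 1)) := by
  have h := runsIn_pop k v (savedStore s k w n)
  have hh : (savedStore s k w n k).head? = w[n]? := by simp [savedStore]
  have ht : Function.update (savedStore s k w n) k (savedStore s k w n k).tail =
      Function.update (Function.update s 0 (w.take n).reverse) k (w.drop (n + 1)) := by
    simp [savedStore]
  rw [hh, ht] at h
  refine h.seq (T' := 2) ?_
  rcases hw : w[n]? with _ | b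
  · refine RunsIn.ite_false rfl ?_
    have hn : w.length ≤ n := by simpa using hw
    have : savedStore s k w (n + 1) =
        Function.update (Function.update s 0 (w.take n).reverse) k (w.drop (n + 1)) := by
      rw [savedStore, List.take_of_length_le hn, List.take_of_length_le (by omega)]
    rw [this]
    exact runsIn_load _ _ _
  · refine RunsIn.ite_true rfl ?_
    have : savedStore s k w (n + 1) = Function.update (Function.update
        (Function.update s 0 (w.take n).reverse) k (w.drop (n + 1))) 0
          (b :: (w.take n).reverse) := by
      rw [savedStore, Function.update_comm hk, Function.update_idem, List.take_add_one, hw]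
      simp
    rw [this]
    have h' := runsIn_push 0 (fun v => v.1.getD false) (some b, v.2)
      (Function.update (Function.update s 0 (w.take n).reverse) k (w.drop (n + 1)))
    simpa [hk.symm] using h'

end StackProg

theorem Polynomial.eval_mono_nat (T : Polynomial ℕ) {x y : ℕ} (h : x ≤ y) :
    T.eval x ≤ T.eval y := by
  rw [Polynomial.eval_eq_sum, Polynomial.eval_eq_sum]
  exact Finset.sum_le_sum fun i _ => Nat.mul_le_mul_left _ (Nat.pow_le_pow_left h i)

/-! ## Terms and predicates that stack programs evaluate -/

/-- A type of contexts: its elements are stored in the stacks below `depth`. The stack `0` is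
empty, and the stacks `1` and `2` hold the two input words. -/
class Ctx (α : Type) where
  /-- The number of stacks in use. -/
  depth : ℕ
  /-- The store represents the context. -/
  Holds : α → Store → Prop
  /-- The input words. -/
  input : α → List Bool × List Bool
  /-- The size of the context. -/
  size : α → ℕ
  three_le : 3 ≤ depth
  holds_congr {a s s'} : (∀ k < depth, s k = s' k) → Holds a s → Holds a s'
  holds_zero {a s} : Holds a s → s 0 = []
  holds_one {a s} : Holds a s → s 1 = (input a).1
  holds_two {a s} : Holds a s → s 2 = (input a).2
  length_le a : (input a).1.length + (input a).2.length ≤ size a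

instance : Ctx (List Bool × List Bool) where
  depth := 3
  Holds a s := s 0 = [] ∧ s 1 = a.1 ∧ s 2 = a.2
  input a := a
  size a := a.1.length + a.2.length
  three_le := le_rfl
  holds_congr h hs := by
    rwa [← h 0 (by omega), ← h 1 (by omega), ← h 2 (by omega)]
  holds_zero h := h.1
  holds_one h := h.2.1
  holds_two h := h.2.2
  length_le _ := le_rfl

/-- The extension of a context by a number: it is held in unary on a new stack. One more stack is
reserved for the control of the loop that enumerates the numbers. -/
instance (α : Type) [Ctx α] : Ctx (α × ℕ) where
  depth := Ctx.depth α + 2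
  Holds a s := Ctx.Holds a.1 s ∧ s (Ctx.depth α) = List.replicate a.2 true
  input a := Ctx.input a.1
  size a := Ctx.size a.1 + a.2
  three_le := (Ctx.three_le (α := α)).trans (Nat.le_add_right _ _)
  holds_congr h hs := ⟨Ctx.holds_congr (fun k hk => h k (by omega)) hs.1,
    by rw [← h _ (by omega), hs.2]⟩
  holds_zero h := Ctx.holds_zero h.1
  holds_one h := Ctx.holds_one h.1
  holds_two h := Ctx.holds_two h.1
  length_le a := (Ctx.length_le a.1).trans (Nat.le_add_right _ _)

open StackProg

section Definable

variable {α : Type} [Ctx α]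

/-- The values of `f` are polynomially bounded and some program computes them in unary in
polynomial time. -/
def Tm (f : α → ℕ) : Prop :=
  ∃ (p : ℕ → ℕ → StackProg) (T : Polynomial ℕ), ∀ a, f a ≤ T.eval (Ctx.size a) ∧
    -- The result goes on top of stack `d`, so that sums accumulate; the stacks from `j` on are
    -- scratch space, empty before and after.
    ∀ v s d j, Ctx.Holds a s → Ctx.depth α ≤ d → d < j → (∀ k ≥ j, s k = []) →
      ∃ v', RunsIn (T.eval (Ctx.size a)) (p d j) (v, s)
        (v', Function.update s d (List.replicate (f a) true ++ s d))

/-- Some program decides the predicate `P` in polynomial time. -/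
def FO (P : α → Prop) : Prop :=
  ∃ (p : StackProg) (T : Polynomial ℕ), ∀ a v s, Ctx.Holds a s →
    (∀ k ≥ Ctx.depth α, s k = []) → ∃ v', RunsIn (T.eval (Ctx.size a)) p (v, s) (v', s) ∧
      (v'.2 = true ↔ P a)

/-! ### Closure properties of terms and predicates -/

theorem Tm.const (c : ℕ) : Tm fun _ : α => c := by
  refine ⟨fun d _ => Nat.rec skip (fun _ p => seq p (push d fun _ => true)) c,
    Polynomial.C (c + 1), fun a => ⟨by simp, fun v s d j _ _ _ _ => ?_⟩⟩
  rw [Polynomial.eval_C]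
  induction c with
  | zero => exact ⟨v, by simpa using! runsIn_load id v s⟩
  | succ c ih =>
    obtain ⟨v', h⟩ := ih
    have h' := h.seq (runsIn_push d (fun _ => true) _ _)
    exact ⟨v', by simpa [List.replicate_succ] using h'⟩

theorem Tm.add {f g : α → ℕ} (hf : Tm f) (hg : Tm g) : Tm fun a => f a + g a := by
  obtain ⟨p, T, hp⟩ := hf
  obtain ⟨q, T', hq⟩ := hg
  refine ⟨fun d j => seq (p d j) (q d j), T + T', fun a => ⟨?_, fun v s d j hs hd hj he => ?_⟩⟩
  · rw [Polynomial.eval_add]; exact Nat.add_le_add (hp a).1 (hq a).1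
  · obtain ⟨v', h⟩ := (hp a).2 v s d j hs hd hj he
    obtain ⟨v'', h'⟩ := (hq a).2 v' (Function.update s d (List.replicate (f a) true ++ s d)) d j
      (Ctx.holds_congr (fun k hk => by rw [Function.update_of_ne (by omega)]) hs) hd hj
      (fun k hk => by rw [Function.update_of_ne (by omega), he k hk])
    refine ⟨v'', ?_⟩
    rw [Polynomial.eval_add]
    have := h.seq h'
    rw [Function.update_self, Function.update_idem, ← List.append_assoc, ← List.replicate_add,
      Nat.add_comm (g a)] at this
    exact this

/-- The first factor is computed on the scratch stack `j` and serves as a loop counter; each round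
adds the second factor to stack `d`. -/
theorem Tm.mul {f g : α → ℕ} (hf : Tm f) (hg : Tm g) : Tm fun a => f a * g a := by
  obtain ⟨p, T, hp⟩ := hf
  obtain ⟨q, T', hq⟩ := hg
  refine ⟨fun d j => seq (p j (j + 1)) (forPop j (q d (j + 1))), T + ((T' + 3) * T + 2),
    fun a => ⟨?_, fun v s d j hs hd hj he => ?_⟩⟩
  · have h := Nat.mul_le_mul (hp a).1 (hq a).1
    simp only [Polynomial.eval_add, Polynomial.eval_mul, Polynomial.eval_ofNat]
    nlinarith
  · have hj' : s j = [] := he j le_rfl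
    obtain ⟨v', h⟩ := (hp a).2 v s j (j + 1) hs (by omega) (by omega) fun k hk => he k (by omega)
    rw [hj', List.append_nil] at h
    obtain ⟨v'', h'⟩ := runsIn_forPop_replicate (k := j) (p := q d (j + 1))
      (T := T'.eval (Ctx.size a)) (t := f a)
      (fun i => Function.update s d (List.replicate (i * g a) true ++ s d))
      (fun i hi v => by
        obtain ⟨v', h⟩ := (hq a).2 v (Function.update (Function.update s d
            (List.replicate (i * g a) true ++ s d)) j (List.replicate (f a - i - 1) true)) d (j + 1)
          (Ctx.holds_congr (fun k hk => by
            rw [Function.update_of_ne (by omega), Function.update_of_ne (by omega)]) hs) hd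
          (by omega) (fun k hk => by
            rw [Function.update_of_ne (by omega), Function.update_of_ne (by omega),
              he k (by omega)])
        refine ⟨v', ?_⟩
        have hc := fun l => Function.update_comm hj.ne'
          (List.replicate (f a - i - 1) true) l s
        rw [← hc, Function.update_self, Function.update_idem, ← List.append_assoc,
          ← List.replicate_add, Nat.add_comm (g a), ← Nat.succ_mul, hc, hc] at h
        exact h) v'
    refine ⟨v'', (h.seq ?_).mono (?_ : _ + ((T'.eval (Ctx.size a) + 3) * f a + 2) ≤ _)⟩
    · have h₀ : Function.update (Function.update s d (List.replicate (f a * g a) true ++ s d)) j [] =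
          Function.update s d (List.replicate (f a * g a) true ++ s d) :=
        Function.update_eq_self_iff.2 (by rw [Function.update_of_ne hj.ne', hj'])
      rw [h₀] at h'
      simpa using h'
    · have := Nat.mul_le_mul_left (T'.eval (Ctx.size a) + 3) (hp a).1
      simp only [Polynomial.eval_add, Polynomial.eval_mul, Polynomial.eval_ofNat]
      omega

/-- The length of a stack of a context is a term. -/
theorem tm_length {f : α → ℕ} {i : ℕ} (h₀ : i ≠ 0) (hi : i < Ctx.depth α)
    (hf : ∀ a s, Ctx.Holds a s → (s i).length = f a) (T : Polynomial ℕ)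
    (hT : ∀ a, f a ≤ T.eval (Ctx.size a)) : Tm f := by
  refine ⟨fun d _ => pushLength i d, 9 * T + 4, fun a => ⟨?_, fun v s d j hs hd hj he => ?_⟩⟩
  · have := hT a
    simp only [Polynomial.eval_add, Polynomial.eval_mul, Polynomial.eval_ofNat]
    omega
  · obtain ⟨v', h⟩ := runsIn_pushLength (i := i) (d := d) h₀ (by omega) (by omega) v s
      (Ctx.holds_zero hs)
    rw [hf a s hs] at h
    refine ⟨v', h.mono ?_⟩
    have := hT a
    simp only [Polynomial.eval_add, Polynomial.eval_mul, Polynomial.eval_ofNat]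
    omega

theorem Tm.length_fst : Tm fun a : α => (Ctx.input a).1.length :=
  tm_length (i := 1) one_ne_zero (Ctx.three_le.trans' (by norm_num))
    (fun a s hs => by rw [Ctx.holds_one hs]) Polynomial.X fun a => by
      have := Ctx.length_le a
      rw [Polynomial.eval_X]
      omega

theorem Tm.snd : Tm fun a : α × ℕ => a.2 :=
  tm_length (i := Ctx.depth α) (by have := Ctx.three_le (α := α); omega)
    (Nat.lt_add_of_pos_right two_pos) (fun a s hs => by rw [hs.2, List.length_replicate])
    Polynomial.X fun a => by
      rw [Polynomial.eval_X]
      exact Nat.le_add_left _ _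

/-- The program for `f` is told where to put its result and its scratch space, so it runs unchanged
in the larger context. -/
theorem Tm.fst {f : α → ℕ} (hf : Tm f) : Tm fun a : α × ℕ => f a.1 := by
  obtain ⟨p, T, hp⟩ := hf
  refine ⟨p, T, fun a => ?_⟩
  have hle : T.eval (Ctx.size a.1) ≤ T.eval (Ctx.size a) :=
    T.eval_mono_nat (Nat.le_add_right _ _)
  refine ⟨(hp a.1).1.trans hle, fun v s d j hs hd hj he => ?_⟩
  obtain ⟨v', h⟩ := (hp a.1).2 v s d j hs.1 ((Nat.le_add_right _ _).trans hd) hj he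
  exact ⟨v', h.mono hle⟩

/-- Popping one unit of `g a` for each unit of `f a` leaves the truncated difference `g a - f a`; a
further pop yields a symbol exactly if this is positive. -/
theorem FO.lt {f g : α → ℕ} (hf : Tm f) (hg : Tm g) : FO fun a => f a < g a := by
  obtain ⟨p, T, hp⟩ := hf
  obtain ⟨q, T', hq⟩ := hg
  set d := Ctx.depth α with hd
  refine ⟨seq (p d (d + 1)) (seq (q (d + 1) (d + 2)) (seq (forPop d (pop (d + 1)))
    (seq (pop (d + 1)) (seq (load fun v => (none, v.1.isSome)) (clear (d + 1)))))),
    T + (T' + ((4 * T + 2) + (1 + (1 + (4 * T' + 2))))), fun a v s hs he => ?_⟩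
  have hd0 : s d = [] := he d le_rfl
  have hd1 : s (d + 1) = [] := he _ (Nat.le_succ _)
  obtain ⟨v₁, h₁⟩ := (hp a).2 v s d (d + 1) hs le_rfl (Nat.lt_succ_self _)
    fun k hk => he k (by omega)
  obtain ⟨v₂, h₂⟩ := (hq a).2 v₁ (Function.update s d (List.replicate (f a) true ++ s d)) (d + 1)
    (d + 2) (Ctx.holds_congr (fun k hk => by rw [Function.update_of_ne (by omega)]) hs)
    (Nat.le_succ _) (Nat.lt_succ_self _) fun k hk => by
      rw [Function.update_of_ne (by omega), he k (by omega)]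
  rw [Function.update_of_ne (a := d + 1) (by omega), hd0, hd1, List.append_nil, List.append_nil,
    Function.update_comm (by omega)] at h₂
  rw [hd0, List.append_nil] at h₁
  obtain ⟨v₃, h₃⟩ := runsIn_forPop_replicate (k := d) (p := pop (d + 1)) (T := 1) (t := f a)
    (fun i => Function.update s (d + 1) (List.replicate (g a - i) true))
    (fun i hi v => by
      have h := runsIn_pop (d + 1) v (Function.update (Function.update s (d + 1)
        (List.replicate (g a - i) true)) d (List.replicate (f a - i - 1) true))
      rw [Function.update_of_ne (a := d + 1) (by omega), Function.update_self,
        Function.update_comm (by omega), Function.update_idem, List.tail_replicate,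
        Nat.sub_sub (g a)] at h
      have hc := fun l => Function.update_comm (Nat.succ_ne_self d) l
        (List.replicate (f a - i - 1) true) s
      rw [← hc, ← hc] at h
      exact ⟨_, h⟩) v₂
  have h₀ : Function.update (Function.update s (d + 1) (List.replicate (g a - f a) true)) d [] =
      Function.update s (d + 1) (List.replicate (g a - f a) true) :=
    Function.update_eq_self_iff.2 (by rw [Function.update_of_ne (by omega), hd0])
  rw [h₀] at h₃
  have h₄ := runsIn_pop (d + 1) v₃ (Function.update s (d + 1) (List.replicate (g a - f a) true))
  rw [Function.update_self, Function.update_idem] at h₄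
  obtain ⟨v₄, h₅, hf⟩ := runsIn_clear (d + 1)
    (none, (List.replicate (g a - f a) true).head?.isSome)
    (Function.update s (d + 1) (List.replicate (g a - f a) true).tail)
  rw [Function.update_idem, Function.update_self, ← hd1, Function.update_eq_self] at h₅
  refine ⟨v₄, (h₁.seq (h₂.seq (h₃.seq (h₄.seq ((runsIn_load _ _ _).seq h₅))))).mono ?_, ?_⟩
  · have := (hp a).1
    have := (hq a).1
    simp only [Polynomial.eval_add, Polynomial.eval_mul, Polynomial.eval_ofNat,
      Polynomial.eval_one, List.length_tail, List.length_replicate]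
    omega
  · rw [hf]
    simp [List.head?_replicate]
    omega

/-- After `f a` pops that save the bits on stack `0`, the next pop reads the bit in question, or
`none` beyond the end. Moving everything back restores the word. -/
theorem fo_bit {f : α → ℕ} (hf : Tm f) {w : α → List Bool} {i : ℕ} (h₀ : i ≠ 0)
    (hi : i < Ctx.depth α) (hw : ∀ a s, Ctx.Holds a s → s i = w a)
    (hle : ∀ a, (w a).length ≤ Ctx.size a) : FO fun a => (w a)[f a]? = some true := by
  obtain ⟨p, T, hp⟩ := hf
  set d := Ctx.depth α with hd
  refine ⟨seq (p d (d + 1)) (seq (forPop d (popSave i)) (seq (popSave i)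
    (seq (load fun v => (none, v.1.getD false)) (move 0 i)))),
    T + ((6 * T + 2) + (3 + (1 + (4 * Polynomial.X + 2)))), fun a v s hs he => ?_⟩
  have hd0 : s d = [] := he d le_rfl
  have hi' : i ≠ d := hi.ne
  have hdp : d ≠ 0 := by omega
  obtain ⟨v₁, h₁⟩ := (hp a).2 v s d (d + 1) hs le_rfl (Nat.lt_succ_self _)
    fun k hk => he k (by omega)
  rw [hd0, List.append_nil] at h₁
  have hsave : savedStore s i (w a) 0 = s := by
    rw [savedStore, List.take_zero, List.reverse_nil, List.drop_zero,
      ← Ctx.holds_zero hs, Function.update_eq_self, ← hw a s hs, Function.update_eq_self]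
  have hcomm : ∀ n l, Function.update (savedStore s i (w a) n) d l =
      savedStore (Function.update s d l) i (w a) n := by
    intro n l
    rw [savedStore, savedStore, Function.update_comm hi', Function.update_comm hdp.symm]
  obtain ⟨v₂, h₂⟩ := runsIn_forPop_replicate (k := d) (p := popSave i) (T := 3) (t := f a)
    (savedStore s i (w a))
    (fun n hn v => ⟨_, by rw [hcomm, hcomm]; exact runsIn_popSave h₀ v _ _ _⟩) v₁
  rw [hsave, hcomm, ← hd0, Function.update_eq_self] at h₂
  have h₃ := runsIn_popSave h₀ v₂ s (w a) (f a)
  obtain ⟨v₃, h₄, hf⟩ := runsIn_move (j := 0) (k := i) h₀.symm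
    (none, (w a)[f a]?.getD false) (savedStore s i (w a) (f a + 1))
  have hs₀ : savedStore s i (w a) (f a + 1) 0 = ((w a).take (f a + 1)).reverse := by
    simp [savedStore, h₀.symm]
  have hs₁ : savedStore s i (w a) (f a + 1) i = (w a).drop (f a + 1) := by
    simp [savedStore]
  have hs₂ : Function.update (Function.update (savedStore s i (w a) (f a + 1)) 0 []) i (w a) = s := by
    rw [savedStore, Function.update_comm h₀, Function.update_idem, Function.update_idem,
      ← Ctx.holds_zero hs, Function.update_eq_self, ← hw a s hs, Function.update_eq_self]
  rw [hs₀, hs₁, List.reverse_reverse, List.take_append_drop, hs₂] at h₄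
  refine ⟨v₃, (h₁.seq (h₂.seq (h₃.seq ((runsIn_load _ _ _).seq h₄)))).mono ?_, ?_⟩
  · have := (hp a).1
    have := hle a
    simp only [Polynomial.eval_add, Polynomial.eval_mul, Polynomial.eval_ofNat,
      Polynomial.eval_one, Polynomial.eval_X, List.length_reverse, List.length_take]
    omega
  · rw [hf]
    rcases h : (w a)[f a]? with _ | b <;> simp [h]

theorem FO.not {P : α → Prop} (hP : FO P) : FO fun a => ¬ P a := by
  obtain ⟨p, T, hp⟩ := hP
  refine ⟨seq p (load fun v => (v.1, !v.2)), T + 1, fun a v s hs he => ?_⟩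
  obtain ⟨v', h, hv⟩ := hp a v s hs he
  refine ⟨(v'.1, !v'.2), ?_, by simp [← hv]⟩
  rw [Polynomial.eval_add, Polynomial.eval_one]
  exact h.seq (runsIn_load _ _ _)

theorem FO.and {P Q : α → Prop} (hP : FO P) (hQ : FO Q) : FO fun a => P a ∧ Q a := by
  obtain ⟨p, T, hp⟩ := hP
  obtain ⟨q, T', hq⟩ := hQ
  refine ⟨seq p (ite (fun v => v.2) q skip), T + (T' + 2), fun a v s hs he => ?_⟩
  obtain ⟨v', h, hv⟩ := hp a v s hs he
  obtain ⟨v'', h', hv'⟩ := hq a v' s hs he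
  simp only [Polynomial.eval_add, Polynomial.eval_ofNat]
  cases hf : v'.2
  · exact ⟨v', h.seq ((RunsIn.ite_false hf (runsIn_load id v' s)).mono (by omega)),
      by simp [← hv, hf]⟩
  · exact ⟨v'', h.seq ((RunsIn.ite_true hf h').mono (by omega)), by simp [← hv, hf, hv']⟩

/-- Exhaustive search: stack `d` holds the candidate `x` in unary, as the context `α × ℕ` demands,
and the second stack reserved by that context counts the candidates left. A success clears the
counter, which ends the loop with the flag set. -/
theorem FO.ex {t : α → ℕ} (ht : Tm t) {P : α → ℕ → Prop} (hP : FO fun a : α × ℕ => P a.1 a.2) :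
    FO fun a => ∃ x < t a, P a x := by
  obtain ⟨p, T, hp⟩ := ht
  obtain ⟨q, T', hq⟩ := hP
  set d := Ctx.depth α with hd
  refine ⟨seq (p (d + 1) (d + 2)) (seq (load fun _ => (none, false)) (seq
    (forPop (d + 1) (seq q (ite (fun v => v.2) (clear (d + 1)) (push d fun _ => true)))) (clear d))),
    -- The context `(a, x)` has size at most `Ctx.size a` plus the bound on `t a`, hence the
    -- composition. The summand `4 * T + 3` pays for the branch that clears the counter.
    T + (1 + (((T'.comp (Polynomial.X + T) + (4 * T + 3) + 3) * T + 2) + (4 * T + 2))),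
    fun a v s hs he => ?_⟩
  have hd0 : s d = [] := he d le_rfl
  have hd1 : s (d + 1) = [] := he _ (Nat.le_succ _)
  have hpT := (hp a).1
  obtain ⟨v₁, h₁⟩ := (hp a).2 v s (d + 1) (d + 2) hs (Nat.le_succ _) (Nat.lt_succ_self _)
    fun k hk => he k (by omega)
  rw [hd1, List.append_nil] at h₁
  obtain ⟨v₃, s₃, h₃, hk, x, r, hsx, hor⟩ := runsIn_forPop (k := d + 1)
    (p := seq q (ite (fun v => v.2) (clear (d + 1)) (push d fun _ => true)))
    (T := T'.eval (Ctx.size a + T.eval (Ctx.size a)) + (4 * T.eval (Ctx.size a) + 3))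
    -- Either all candidates below `x` failed and `r` are left, or `x` succeeded and the counter is
    -- empty.
    (fun b s' => ∃ x r,
      s' = Function.update (Function.update s d (List.replicate x true)) (d + 1)
        (List.replicate r true) ∧
      (b = false ∧ x + r = t a ∧ (∀ y < x, ¬ P a y) ∨ b = true ∧ r = 0 ∧ x < t a ∧ P a x))
    (fun b l fl s' hl ⟨x, r, hsx, hor⟩ => by
      rw [hsx, Function.update_self] at hl
      rcases r with _ | r
      · simp at hl
      rw [List.replicate_succ, List.cons_eq_cons] at hl
      obtain ⟨-, rfl⟩ := hl
      rcases hor with ⟨rfl, hxr, hx⟩ | ⟨-, h, -⟩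
      swap
      · simp at h
      rw [hsx, Function.update_idem]
      set s₁ := Function.update (Function.update s d (List.replicate x true)) (d + 1)
        (List.replicate r true) with hs₁
      have hs₁d : s₁ d = List.replicate x true := by simp [hs₁]
      obtain ⟨v', h, hv⟩ := hq (a, x) (some b, false) s₁
        ⟨Ctx.holds_congr (fun k hk => by
            rw [hs₁, Function.update_of_ne (by omega), Function.update_of_ne (by omega)]) hs, hs₁d⟩
        (fun k hk => by
          have hk' : d + 2 ≤ k := hk
          rw [hs₁, Function.update_of_ne (by omega), Function.update_of_ne (by omega),
            he k (by omega)])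
      have hT' : T'.eval (Ctx.size (a, x)) ≤ T'.eval (Ctx.size a + T.eval (Ctx.size a)) :=
        T'.eval_mono_nat (Nat.add_le_add_left (by omega) _)
      cases hf : v'.2
      · refine ⟨v', _, (h.seq (RunsIn.ite_false hf (runsIn_push _ _ _ _))).mono (by omega), ?_,
          x + 1, r, ?_, Or.inl ⟨hf, by omega, fun y hy => ?_⟩⟩
        · simp [hs₁]
        · rw [hs₁d, hs₁, Function.update_comm (by omega), Function.update_idem]
          rfl
        · rcases Nat.lt_succ_iff_lt_or_eq.mp hy with hy | rfl
          · exact hx y hy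
          · exact fun hP => by simp [hv.mpr hP] at hf
      · obtain ⟨v'', h', hv''⟩ := runsIn_clear (d + 1) v' s₁
        have hlen : (s₁ (d + 1)).length = r := by simp [hs₁]
        rw [hlen] at h'
        refine ⟨v'', _, (h.seq (RunsIn.ite_true hf h')).mono (by omega), by simp, x, 0, ?_,
          Or.inr ⟨hv''.trans hf, rfl, by omega, hv.mp hf⟩⟩
        rw [hs₁, Function.update_idem]
        rfl)
    (none, false) (Function.update s (d + 1) (List.replicate (t a) true))
    ⟨0, t a, by rw [List.replicate_zero, ← hd0, Function.update_eq_self], Or.inl ⟨rfl, by simp, by simp⟩⟩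
  rw [hsx, Function.update_self] at hk
  have hr : r = 0 := by simpa using hk
  subst hr
  rw [List.replicate_zero, ← hd1, Function.update_comm (by omega), Function.update_eq_self] at hsx
  obtain ⟨v₄, h₄, hf⟩ := runsIn_clear d v₃ s₃
  rw [hsx, Function.update_idem, ← hd0, Function.update_eq_self, Function.update_self,
    List.length_replicate] at h₄
  rw [hsx] at h₃
  refine ⟨v₄, (h₁.seq ((runsIn_load _ _ _).seq (h₃.seq h₄))).mono ?_, ?_⟩
  · rw [Function.update_self, List.length_replicate]
    have hx : x ≤ T.eval (Ctx.size a) := by rcases hor with h | h <;> omega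
    have := Nat.mul_le_mul_left (T'.eval (Ctx.size a + T.eval (Ctx.size a)) +
      (4 * T.eval (Ctx.size a) + 3) + 3) hpT
    simp only [Polynomial.eval_add, Polynomial.eval_mul, Polynomial.eval_ofNat,
      Polynomial.eval_one, Polynomial.eval_comp, Polynomial.eval_X]
    omega
  · rw [hf]
    rcases hor with ⟨h, hx, hP⟩ | ⟨h, -, hx, hP⟩
    · rw [h]
      simp only [Bool.false_eq_true, false_iff, not_exists, not_and]
      exact fun y hy => hP y (by omega)
    · exact iff_of_true h ⟨x, hx, hP⟩

theorem FO.bit_fst {f : α → ℕ} (hf : Tm f) : FO fun a => (Ctx.input a).1[f a]? = some true :=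
  fo_bit hf one_ne_zero (Ctx.three_le.trans' (by norm_num)) (fun _ _ hs => Ctx.holds_one hs)
    fun a => (Nat.le_add_right _ _).trans (Ctx.length_le a)

theorem FO.bit_snd {f : α → ℕ} (hf : Tm f) : FO fun a => (Ctx.input a).2[f a]? = some true :=
  fo_bit hf two_ne_zero (Ctx.three_le.trans' (by norm_num)) (fun _ _ hs => Ctx.holds_two hs)
    fun a => (Nat.le_add_left _ _).trans (Ctx.length_le a)

theorem FO.of_iff {P Q : α → Prop} (hP : FO P) (h : ∀ a, P a ↔ Q a) : FO Q :=
  (funext fun a => propext (h a) : P = Q) ▸ hP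

theorem fo_true : FO fun _ : α => True :=
  (FO.lt (Tm.const 0) (Tm.const 1)).of_iff fun _ => by simp

theorem fo_false : FO fun _ : α => False :=
  (FO.lt (Tm.const 0) (Tm.const 0)).of_iff fun _ => by simp

theorem FO.or {P Q : α → Prop} (hP : FO P) (hQ : FO Q) : FO fun a => P a ∨ Q a :=
  (hP.not.and hQ.not).not.of_iff fun a => by tauto

theorem FO.imp {P Q : α → Prop} (hP : FO P) (hQ : FO Q) : FO fun a => P a → Q a :=
  (hP.and hQ.not).not.of_iff fun a => by tauto

theorem FO.iff {P Q : α → Prop} (hP : FO P) (hQ : FO Q) : FO fun a => P a ↔ Q a :=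
  ((hP.imp hQ).and (hQ.imp hP)).of_iff fun a => by tauto

theorem FO.le {f g : α → ℕ} (hf : Tm f) (hg : Tm g) : FO fun a => f a ≤ g a :=
  (FO.lt hg hf).not.of_iff fun _ => not_lt

theorem FO.eq {f g : α → ℕ} (hf : Tm f) (hg : Tm g) : FO fun a => f a = g a :=
  ((FO.le hf hg).and (FO.le hg hf)).of_iff fun _ => le_antisymm_iff.symm

theorem FO.ne {f g : α → ℕ} (hf : Tm f) (hg : Tm g) : FO fun a => f a ≠ g a :=
  (FO.eq hf hg).not

theorem FO.all {t : α → ℕ} (ht : Tm t) {P : α → ℕ → Prop} (hP : FO fun a : α × ℕ => P a.1 a.2) :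
    FO fun a => ∀ x < t a, P a x :=
  (FO.ex ht (P := fun a x => ¬ P a x) hP.not).not.of_iff fun a => by push Not; rfl

end Definable

open Classical in
/-- A definable predicate of pairs of words is decidable in polynomial time. -/
theorem FO.nonempty_polyTime {P : List Bool × List Bool → Prop} (hP : FO P) :
    Nonempty (Turing.TM2ComputableInPolyTime encodePair Computability.encodeBool
      fun x => decide (P x)) := by
  obtain ⟨p, T, hp⟩ := hP
  -- The words arrive reversed, and moving them reverses them again. The final clearing keeps the
  -- flag.
  refine StackProg.nonempty_polyTime (seq (move 3 1) (seq (move 4 2) (seq p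
    (seq (clear 1) (clear 2))))) ((4 * Polynomial.X + 2) + ((4 * Polynomial.X + 2) + (T +
      ((4 * Polynomial.X + 2) + (4 * Polynomial.X + 2))))) _ fun w c => ?_
  set s : Store := fun k => if k = 1 then w else if k = 2 then c else [] with hs
  obtain ⟨v₁, h₁, -⟩ := runsIn_move (j := 3) (k := 1) (by norm_num) (none, false)
    (inputStore w.reverse c.reverse)
  set s₁ := Function.update (Function.update (inputStore w.reverse c.reverse) 3 []) 1
    ((inputStore w.reverse c.reverse 3).reverse ++ inputStore w.reverse c.reverse 1) with hs₁
  obtain ⟨v₂, h₂, -⟩ := runsIn_move (j := 4) (k := 2) (by norm_num) v₁ s₁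
  have e₂ : Function.update (Function.update s₁ 4 []) 2 ((s₁ 4).reverse ++ s₁ 2) = s := by
    funext k
    by_cases h2 : k = 2
    · subst h2; simp [hs, hs₁, inputStore]
    by_cases h4 : k = 4
    · subst h4; simp [hs]
    by_cases h1 : k = 1
    · subst h1; simp [hs, hs₁, inputStore]
    by_cases h3 : k = 3
    · subst h3; simp [hs, hs₁]
    simp [hs, hs₁, inputStore, h1, h2, h3, h4]
  rw [e₂] at h₂
  obtain ⟨v₃, h₃, hv⟩ := hp (w, c) v₂ s (show s 0 = [] ∧ s 1 = w ∧ s 2 = c by simp [hs])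
    fun k hk => by
      have hk' : 3 ≤ k := hk
      simp only [hs]
      rw [if_neg (by omega), if_neg (by omega)]
  obtain ⟨v₄, h₄, hf₄⟩ := runsIn_clear 1 v₃ s
  obtain ⟨v₅, h₅, hf₅⟩ := runsIn_clear 2 v₄ (Function.update s 1 [])
  have e₅ : Function.update (Function.update s 1 []) 2 [] = fun _ => [] := by
    funext k
    by_cases h1 : k = 1 <;> by_cases h2 : k = 2 <;> simp [hs, h1, h2]
  rw [e₅] at h₅
  obtain ⟨n, hn, hr⟩ := h₁.seq (h₂.seq (h₃.seq (h₄.seq h₅)))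
  have hv₅ : v₅ = (v₅.1, decide (P (w, c))) := by
    refine Prod.ext rfl ?_
    rw [hf₅, hf₄, Bool.eq_iff_iff, hv, decide_eq_true_iff]
  refine ⟨n, hn.trans ?_, v₅.1, hv₅ ▸ hr⟩
  have l₁ : (inputStore w.reverse c.reverse 3).length = w.length := by simp [inputStore]
  have l₂ : (s₁ 4).length = c.length := by simp [hs₁, inputStore]
  have l₃ : (s 1).length = w.length := by simp [hs]
  have l₄ : (Function.update s 1 [] 2).length = c.length := by simp [hs]
  have l₅ : Ctx.size (w, c) = w.length + c.length := rfl
  simp only [Polynomial.eval_add, Polynomial.eval_mul, Polynomial.eval_ofNat, Polynomial.eval_X]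
  rw [l₁, l₂, l₃, l₄, l₅]
  omega

/-! ## Trees -/

namespace Plant

variable {AP S : Type*}

/-- The state is the end of a walk of the given length from the root. -/
def WalkFrom (P : Plant AP S) (root : S) : ℕ → S → Prop
  | 0, s => s = root
  | k + 1, s => ∃ u, P.WalkFrom root k u ∧ P.Edge u s

/-- In a tree, there is a depth function that increases by one along all edges between distinct
states. -/
theorem exists_depth {P : Plant AP S} {root : S}
    (hreach : ∀ s, Relation.ReflTransGen P.Edge root s) (hroot : ∀ s, P.Edge s root → s = root)
    (huniq : ∀ s, s ≠ root → ∃! s', s' ≠ s ∧ P.Edge s' s) :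
    ∃ d : S → ℕ, ∀ s t, P.Edge s t → s ≠ t → d t = d s + 1 := by
  classical
  have hw : ∀ s, ∃ k, P.WalkFrom root k s := fun s => by
    induction hreach s with
    | refl => exact ⟨0, rfl⟩
    | tail _ he ih =>
      obtain ⟨k, hk⟩ := ih
      exact ⟨k + 1, _, hk, he⟩
  refine ⟨fun s => Nat.find (hw s), fun s t he hne => le_antisymm ?_ ?_⟩
  · exact Nat.find_min' _ ⟨s, Nat.find_spec (hw s), he⟩
  · have htr : t ≠ root := fun h => hne ((hroot s (h ▸ he)).trans h.symm)
    have hspec := Nat.find_spec (hw t)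
    have hmin := fun k => @Nat.find_min _ _ (hw t) k
    change Nat.find (hw s) + 1 ≤ Nat.find (hw t)
    revert hspec hmin
    generalize Nat.find (hw t) = k
    intro hspec hmin
    rcases k with _ | k
    · exact absurd hspec htr
    obtain ⟨u, hu, hut⟩ := hspec
    -- In a shortest walk to `t` the last step is not a self-loop, so it comes from the unique
    -- predecessor `s`.
    have hne' : u ≠ t := fun h => hmin k (Nat.lt_succ_self k) (h ▸ hu)
    have : u = s := (huniq t htr).unique ⟨hne', hut⟩ ⟨hne, he⟩
    subst this
    exact Nat.succ_le_succ (Nat.find_min' (hw u) hu)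

/-- The facts about paths in a tree-shaped plant, for a sequence that follows its edges. -/
theorem TreeShaped.paths {n : ℕ} {P : Plant AP (Fin n)} (hP : P.TreeShaped) :
    (∀ p : ℕ → Fin n, (∀ i, P.Edge (p i) (p (i + 1))) → p (n + 1) = p n) ∧
    ∀ p q : ℕ → Fin n, (∀ i, P.Edge (p i) (p (i + 1))) → (∀ i, P.Edge (q i) (q (i + 1))) →
      p 0 = q 0 → ∀ k, p k = q k → ∀ i ≤ k, p i = q i := by
  obtain ⟨root, hreach, hroot, huniq, hloop⟩ := hP
  obtain ⟨d, hd⟩ := exists_depth hreach hroot huniq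
  have hle : ∀ p : ℕ → Fin n, (∀ i, P.Edge (p i) (p (i + 1))) → ∀ i, d (p i) ≤ d (p 0) + i := by
    intro p hp i
    induction i with
    | zero => exact le_rfl
    | succ i ih =>
      by_cases h : p i = p (i + 1)
      · rw [← h]; omega
      · rw [hd _ _ (hp i) h]; omega
  -- States with a self-loop are never left. So a path that moves at time `i` has moved at all
  -- earlier times, gaining one level each time.
  have heq : ∀ p : ℕ → Fin n, (∀ i, P.Edge (p i) (p (i + 1))) → ∀ i, p i ≠ p (i + 1) →
      ∀ j ≤ i + 1, d (p j) = d (p 0) + j := by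
    intro p hp i
    induction i with
    | zero =>
      intro h j hj
      rcases Nat.le_one_iff_eq_zero_or_eq_one.mp hj with rfl | rfl
      · rfl
      · exact hd _ _ (hp 0) h
    | succ i ih =>
      intro h j hj
      have h' : p i ≠ p (i + 1) := fun h' => h (hloop (p (i + 1)) (p (i + 2))
        (by have := hp i; rwa [h'] at this) (hp (i + 1))).symm
      rcases Nat.le_succ_iff.mp hj with hj | rfl
      · exact ih h' j hj
      · have := ih h' (i + 1) le_rfl
        rw [hd _ _ (hp (i + 1)) h]; omega
  constructor
  · intro p hp
    by_contra hne
    have h := heq p hp n fun h => hne h.symm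
    -- A move at time `n` would produce `n + 1` states of distinct depths.
    have hinj : Function.Injective fun i : Fin (n + 1) => p i := by
      intro i j hij
      have h1 := h i (by omega)
      have h2 := h j (by omega)
      have hij' : p i = p j := hij
      rw [hij'] at h1
      exact Fin.ext (by omega)
    simpa using Fintype.card_le_of_injective _ hinj
  · intro p q hp hq h0 k
    induction k with
    | zero => intro h i hi; rwa [Nat.le_zero.mp hi]
    | succ k ih =>
      intro h
      -- If just one of the paths moved at time `k`, it would now be strictly deeper than the other.
      -- If both moved, predecessors are unique.
      have hk : p k = q k := by
        by_cases hpk : p k = p (k + 1) <;> by_cases hqk : q k = q (k + 1)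
        · rw [hpk, h, hqk]
        · exfalso
          have h1 := heq q hq k hqk (k + 1) le_rfl
          have h2 := hle p hp k
          rw [hpk, h, h0] at h2
          omega
        · exfalso
          have h1 := heq p hp k hpk (k + 1) le_rfl
          have h2 := hle q hq k
          rw [hqk, ← h, ← h0] at h2
          omega
        · have hr : p (k + 1) ≠ root := fun hr => hpk
            ((hroot _ (by have := hp k; rwa [hr] at this)).trans hr.symm)
          exact (huniq _ hr).unique ⟨hpk, hp k⟩ ⟨by rw [h]; exact hqk, by rw [h]; exact hq k⟩
      intro i hi
      rcases Nat.le_succ_iff.mp hi with hi | rfl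
      · exact ih hk i hi
      · exact h

end Plant

/-! ## Certificates -/

section Certificate

variable {AP : Type*}

/-- The relation is the union of two transition relations. -/
def Step (C U : ℕ → ℕ → Prop) (s t : ℕ) : Prop := C s t ∨ U s t

/-- The frame on the states below `n` is a tree, as witnessed by the strict order `O`. -/
def IsTree (n : ℕ) (C U O : ℕ → ℕ → Prop) : Prop :=
  (∀ s < n, ¬ O s s) ∧ (∀ s < n, ∀ t < n, ∀ u < n, O s t → O t u → O s u) ∧
  (∀ s < n, ∀ t < n, Step C U s s → Step C U s t → t = s) ∧
  ∃ r < n, (∀ s < n, Step C U s r → s = r) ∧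
    ∀ s < n, s ≠ r → ∃ s' < n, s' ≠ s ∧ Step C U s' s ∧ O s' s ∧
      ∀ u < n, u ≠ s → Step C U u s → u = s'

/-- The transitions `C'` are among `C`, and with `U` every state keeps an outgoing transition. -/
def IsRestriction (n : ℕ) (C U C' : ℕ → ℕ → Prop) : Prop :=
  (∀ s < n, ∀ t < n, C' s t → C s t) ∧ ∀ s < n, ∃ t < n, Step C' U s t

/-- The rows `l < n` of `R` with `V l` describe all paths; `R l i s` tells that row `l` describes a
path that is in state `s` at time `i ≤ n`, and it stays in the same state from time `n` on. -/
def IsPathTable (n : ℕ) (I : ℕ → Prop) (C U : ℕ → ℕ → Prop) (V : ℕ → Prop)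
    (R : ℕ → ℕ → ℕ → Prop) : Prop :=
  (∃ l < n, V l) ∧ ∀ l < n, V l →
    (∀ i < n + 1, ∃ s < n, R l i s ∧ ∀ t < n, R l i t → t = s) ∧
    (∀ s < n, R l 0 s → I s) ∧
    (∀ i < n, ∀ s < n, R l i s → ∀ t < n, R l (i + 1) t → Step C U s t) ∧
    (∀ s < n, R l n s → Step C U s s) ∧
    -- Completeness of the table, stated locally: every one-step deviation from a prefix of a row is
    -- again a prefix of some row.
    ∀ i < n, ∀ s < n, R l i s → ∀ t < n, Step C U s t →
      ∃ l' < n, V l' ∧ R l' (i + 1) t ∧ ∀ j < i + 1, ∀ u < n, R l j u → R l' j u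

/-- Certificate bits represent a relation only within range, which suffices because all quantifiers
in the conditions are bounded. -/
theorem IsTree.congr {n : ℕ} {C U O O' : ℕ → ℕ → Prop} (h : IsTree n C U O)
    (hO : ∀ s < n, ∀ t < n, (O' s t ↔ O s t)) : IsTree n C U O' := by
  obtain ⟨hirr, htrans, hloop, r, hr, hroot, hpred⟩ := h
  refine ⟨fun s hs h => hirr s hs ((hO s hs s hs).mp h), fun s hs t ht u hu hst htu => ?_, hloop,
    r, hr, hroot, fun s hs hne => ?_⟩
  · exact (hO s hs u hu).mpr
      (htrans s hs t ht u hu ((hO s hs t ht).mp hst) ((hO t ht u hu).mp htu))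
  · obtain ⟨v, hv, hvs, hst, hvO, huniq⟩ := hpred s hs hne
    exact ⟨v, hv, hvs, hst, (hO v hv s hs).mpr hvO, huniq⟩

theorem IsPathTable.congr {n : ℕ} {I : ℕ → Prop} {C U : ℕ → ℕ → Prop} {V V' : ℕ → Prop}
    {R R' : ℕ → ℕ → ℕ → Prop} (h : IsPathTable n I C U V R) (hV : ∀ l < n, (V' l ↔ V l))
    (hR : ∀ l < n, ∀ i < n + 1, ∀ s < n, (R' l i s ↔ R l i s)) : IsPathTable n I C U V' R' := by
  obtain ⟨⟨l₀, hl₀, hV₀⟩, h⟩ := h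
  refine ⟨⟨l₀, hl₀, (hV l₀ hl₀).mpr hV₀⟩, fun l hl hVl => ?_⟩
  obtain ⟨h₁, h₂, h₃, h₄, h₅⟩ := h l hl ((hV l hl).mp hVl)
  refine ⟨fun i hi => ?_, fun s hs hRs => ?_, fun i hi s hs hRs t ht hRt => ?_, fun s hs hRs => ?_,
    fun i hi s hs hRs t ht hst => ?_⟩
  · obtain ⟨s, hs, hRs, hu⟩ := h₁ i hi
    exact ⟨s, hs, (hR l hl i hi s hs).mpr hRs, fun t ht hRt => hu t ht ((hR l hl i hi t ht).mp hRt)⟩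
  · exact h₂ s hs ((hR l hl 0 (by omega) s hs).mp hRs)
  · exact h₃ i hi s hs ((hR l hl i (by omega) s hs).mp hRs) t ht
      ((hR l hl (i + 1) (by omega) t ht).mp hRt)
  · exact h₄ s hs ((hR l hl n (by omega) s hs).mp hRs)
  · obtain ⟨l', hl', hV', hR', hagree⟩ :=
      h₅ i hi s hs ((hR l hl i (by omega) s hs).mp hRs) t ht hst
    exact ⟨l', hl', (hV l' hl').mpr hV', (hR l' hl' (i + 1) (by omega) t ht).mpr hR',
      fun j hj u hu hRu => (hR l' hl' j (by omega) u hu).mpr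
        (hagree j hj u hu ((hR l hl j (by omega) u hu).mp hRu))⟩

/-! ### Evaluation of formulas on path tables -/

/-- The trace that row `l` of a path table describes. -/
def rowTrace (n : ℕ) (R : ℕ → ℕ → ℕ → Prop) (L : ℕ → AP → Prop) (l : ℕ) : Trace AP :=
  fun i => {a | ∃ s < n, R l (min i n) s ∧ L s a}

/-- Satisfaction of a quantifier-free formula at time `q ≤ n` by rows of a path table. -/
def LTLBody.Holds (n : ℕ) (R : ℕ → ℕ → ℕ → Prop) (L : ℕ → AP → Prop) :
    LTLBody AP → (ℕ → Option ℕ) → ℕ → Prop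
  | tt, _, _ => True
  | atom a x, ρ, q => ∃ l, ρ x = some l ∧ ∃ s < n, R l q s ∧ L s a
  | neg ψ, ρ, q => ¬ ψ.Holds n R L ρ q
  | or ψ₁ ψ₂, ρ, q => ψ₁.Holds n R L ρ q ∨ ψ₂.Holds n R L ρ q
  | untl ψ₁ ψ₂, ρ, q => ∃ i < n + 1, q ≤ i ∧ ψ₂.Holds n R L ρ i ∧
      ∀ j < i, q ≤ j → ψ₁.Holds n R L ρ j
  -- Time `n` stands for all later times and is its own successor.
  | next ψ, ρ, q => q < n ∧ ψ.Holds n R L ρ (q + 1) ∨ ¬ q < n ∧ ψ.Holds n R L ρ q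

/-- Satisfaction of a formula by a path table. -/
def HyperLTL.Holds (n : ℕ) (V : ℕ → Prop) (R : ℕ → ℕ → ℕ → Prop) (L : ℕ → AP → Prop) :
    HyperLTL AP → (ℕ → Option ℕ) → Prop
  | ex x φ, ρ => ∃ l < n, V l ∧ φ.Holds n V R L (Function.update ρ x (some l))
  | all x φ, ρ => ∀ l < n, V l → φ.Holds n V R L (Function.update ρ x (some l))
  | body ψ, ρ => ψ.Holds n R L ρ 0

theorem TraceAssignment.suffix_suffix (A : TraceAssignment AP) (i j : ℕ) :
    (A.suffix i).suffix j = A.suffix (i + j) := by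
  funext x
  simp only [suffix, Option.map_map]
  congr 1
  funext t k
  simp [Nat.add_assoc]

theorem TraceAssignment.suffix_zero (A : TraceAssignment AP) : A.suffix 0 = A := by
  funext x
  simp [suffix]

/-- Row traces are constant from time `n` on. -/
theorem suffix_rowTrace {n : ℕ} {R : ℕ → ℕ → ℕ → Prop} {L : ℕ → AP → Prop} (ρ : ℕ → Option ℕ)
    {q : ℕ} (hq : n ≤ q) :
    TraceAssignment.suffix (fun x => (ρ x).map (rowTrace n R L)) q =
      TraceAssignment.suffix (fun x => (ρ x).map (rowTrace n R L)) n := by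
  funext x
  simp only [TraceAssignment.suffix, Option.map_map]
  congr 1
  funext l k
  simp only [Function.comp, rowTrace]
  rw [min_eq_right (by omega), min_eq_right (by omega)]

theorem LTLBody.holds_iff (n : ℕ) (R : ℕ → ℕ → ℕ → Prop) (L : ℕ → AP → Prop) (ψ : LTLBody AP)
    (ρ : ℕ → Option ℕ) (q : ℕ) (hq : q ≤ n) : ψ.Holds n R L ρ q ↔
      ψ.Sat (TraceAssignment.suffix (fun x => (ρ x).map (rowTrace n R L)) q) := by
  induction ψ generalizing q with
  | tt => exact Iff.rfl
  | atom a x =>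
    simp only [Holds, Sat, TraceAssignment.suffix, Option.map_map]
    rcases ρ x with _ | l
    · simp
    · simp [rowTrace, min_eq_left hq]
  | neg ψ ih => exact not_congr (ih q hq)
  | or ψ₁ ψ₂ ih₁ ih₂ => exact or_congr (ih₁ q hq) (ih₂ q hq)
  | untl ψ₁ ψ₂ ih₁ ih₂ =>
    simp only [Holds, Sat, TraceAssignment.suffix_suffix]
    constructor
    · rintro ⟨i, hi, hqi, h₂, h₁⟩
      refine ⟨i - q, ?_, fun j hj => ?_⟩
      · rw [Nat.add_sub_cancel' hqi]
        exact (ih₂ i (by omega)).mp h₂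
      · exact (ih₁ (q + j) (by omega)).mp (h₁ (q + j) (by omega) (by omega))
    · rintro ⟨i, h₂, h₁⟩
      by_cases hi : q + i ≤ n
      · refine ⟨q + i, by omega, by omega, (ih₂ _ hi).mpr h₂, fun j hj hqj => ?_⟩
        refine (ih₁ j (by omega)).mpr ?_
        have := h₁ (j - q) (by omega)
        rwa [Nat.add_sub_cancel' hqj] at this
      -- A witness beyond time `n` sees the same suffixes as time `n`, which is therefore a witness
      -- too.
      · rw [suffix_rowTrace ρ (by omega)] at h₂
        refine ⟨n, by omega, hq, (ih₂ n le_rfl).mpr h₂, fun j hj hqj => ?_⟩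
        refine (ih₁ j (by omega)).mpr ?_
        have := h₁ (j - q) (by omega)
        rwa [Nat.add_sub_cancel' hqj] at this
  | next ψ ih =>
    simp only [Holds, Sat, TraceAssignment.suffix_suffix]
    by_cases hn : q < n
    · simp only [hn, true_and, not_true, false_and, or_false]
      exact ih (q + 1) hn
    · simp only [hn, false_and, not_false_eq_true, true_and, false_or]
      rw [ih q hq, suffix_rowTrace ρ (by omega), suffix_rowTrace ρ (q := q + 1) (by omega)]

theorem HyperLTL.holds_iff (n : ℕ) (V : ℕ → Prop) (R : ℕ → ℕ → ℕ → Prop) (L : ℕ → AP → Prop)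
    (φ : HyperLTL AP) (T : Set (Trace AP))
    (hT : ∀ t, t ∈ T ↔ ∃ l < n, V l ∧ t = rowTrace n R L l) (ρ : ℕ → Option ℕ) :
    φ.Holds n V R L ρ ↔ φ.Sat T fun x => (ρ x).map (rowTrace n R L) := by
  have hupd : ∀ (ρ : ℕ → Option ℕ) x l, (fun y => (Function.update ρ x (some l) y).map
      (rowTrace n R L)) = Function.update (fun y => (ρ y).map (rowTrace n R L)) x
        (some (rowTrace n R L l)) := by
    intro ρ x l
    funext y
    by_cases h : y = x
    · subst h; simp
    · simp [h]
  induction φ generalizing ρ with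
  | ex x φ ih =>
    simp only [Holds, Sat, ih, hupd, hT]
    constructor
    · rintro ⟨l, hl, hV, h⟩
      exact ⟨_, ⟨l, hl, hV, rfl⟩, h⟩
    · rintro ⟨_, ⟨l, hl, hV, rfl⟩, h⟩
      exact ⟨l, hl, hV, h⟩
  | all x φ ih =>
    simp only [Holds, Sat, ih, hupd, hT]
    constructor
    · rintro h _ ⟨l, hl, hV, rfl⟩
      exact h l hl hV
    · intro h l hl hV
      exact h _ ⟨l, hl, hV, rfl⟩
  | body ψ =>
    simp only [Holds, Sat]
    rw [LTLBody.holds_iff n R L ψ ρ 0 (Nat.zero_le n), TraceAssignment.suffix_zero]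

end Certificate

/-! ### Path tables and tree orders of plants -/

namespace Plant

variable {AP : Type*} {n : ℕ}

/-- The relations describe the plant. -/
structure DescribedBy (P : Plant AP (Fin n)) (I : ℕ → Prop) (C U : ℕ → ℕ → Prop)
    (L : ℕ → AP → Prop) : Prop where
  init : ∀ s : Fin n, I s ↔ s = P.init
  ctrl : ∀ s t : Fin n, C s t ↔ P.ctrl s t
  unctrl : ∀ s t : Fin n, U s t ↔ P.unctrl s t
  label : ∀ (s : Fin n) a, L s a ↔ a ∈ P.label s

variable {P : Plant AP (Fin n)} {I : ℕ → Prop} {C U : ℕ → ℕ → Prop} {L : ℕ → AP → Prop}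

theorem DescribedBy.step (h : P.DescribedBy I C U L) (s t : Fin n) :
    Step C U s t ↔ P.Edge s t :=
  or_congr (h.ctrl s t) (h.unctrl s t)

/-- Only reachability from the root is not explicit in `IsTree`. It follows by well-founded
induction along `O`, since each state other than the root has a predecessor that is smaller. -/
theorem DescribedBy.treeShaped (h : P.DescribedBy I C U L) {O : ℕ → ℕ → Prop}
    (hO : IsTree n C U O) : P.TreeShaped := by
  obtain ⟨hirr, htrans, hloop, r, hr, hroot, hpred⟩ := hO
  have hwf : WellFounded fun s t : Fin n => O s t := by
    have : IsTrans (Fin n) fun s t => O s t :=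
      ⟨fun s t u => htrans s s.2 t t.2 u u.2⟩
    have : Std.Irrefl fun s t : Fin n => O s t := ⟨fun s => hirr s s.2⟩
    exact Finite.wellFounded_of_trans_of_irrefl _
  refine ⟨⟨r, hr⟩, fun s => ?_, fun s hs => ?_, fun s hs => ?_, fun s t hs hst => ?_⟩
  · induction s using hwf.induction with
    | _ s ih =>
      by_cases hs : s = ⟨r, hr⟩
      · rw [hs]
      · obtain ⟨u, hu, -, hstep, hOu, -⟩ := hpred s s.2 fun h => hs (Fin.ext h)
        exact (ih ⟨u, hu⟩ hOu).tail ((h.step ⟨u, hu⟩ s).mp hstep)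
  · exact Fin.ext (hroot s s.2 ((h.step s ⟨r, hr⟩).mpr hs))
  · obtain ⟨u, hu, hne, hstep, -, huniq⟩ := hpred s s.2 fun h => hs (Fin.ext h)
    refine ⟨⟨u, hu⟩, ⟨fun h => hne (congrArg Fin.val h), (h.step ⟨u, hu⟩ s).mp hstep⟩, ?_⟩
    rintro v ⟨hv, hvs⟩
    exact Fin.ext (huniq v v.2 (fun h => hv (Fin.ext h)) ((h.step v s).mpr hvs))
  · exact Fin.ext (hloop s s.2 t t.2 ((h.step s s).mpr hs) ((h.step s t).mpr hst))

/-- Comparison of depths is such an order. -/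
theorem DescribedBy.exists_isTree (h : P.DescribedBy I C U L) (hP : P.TreeShaped) :
    ∃ O : ℕ → ℕ → Prop, IsTree n C U O := by
  obtain ⟨root, hreach, hroot, huniq, hloop⟩ := hP
  obtain ⟨d, hd⟩ := exists_depth hreach hroot huniq
  refine ⟨fun s t => ∃ (hs : s < n) (ht : t < n), d ⟨s, hs⟩ < d ⟨t, ht⟩, ?_, ?_, ?_,
    root, root.2, ?_, ?_⟩
  · rintro s - ⟨hs, ht, h⟩
    exact lt_irrefl _ h
  · rintro s - t - u - ⟨hs, ht, h⟩ ⟨_, hu, h'⟩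
    exact ⟨hs, hu, h.trans h'⟩
  · intro s hs t ht h1 h2
    exact congrArg Fin.val (hloop ⟨s, hs⟩ ⟨t, ht⟩ ((h.step _ _).mp h1) ((h.step ⟨s, hs⟩ ⟨t, ht⟩).mp h2))
  · intro s hs h1
    exact congrArg Fin.val (hroot ⟨s, hs⟩ ((h.step ⟨s, hs⟩ root).mp h1))
  · intro s hs hne
    obtain ⟨u, ⟨hus, he⟩, hu⟩ := huniq ⟨s, hs⟩ fun h => hne (congrArg Fin.val h)
    refine ⟨u, u.2, fun h => hus (Fin.ext h), (h.step u ⟨s, hs⟩).mpr he,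
      ⟨u.2, hs, by rw [hd _ _ he hus]; exact Nat.lt_succ_self _⟩, fun v hv hvs hst => ?_⟩
    exact congrArg Fin.val (hu ⟨v, hv⟩ ⟨fun h => hvs (congrArg Fin.val h),
      (h.step ⟨v, hv⟩ ⟨s, hs⟩).mp hst⟩)

/-- A path table describes the traces. -/
theorem DescribedBy.mem_traces_iff (h : P.DescribedBy I C U L)
    (hloop : ∀ s t, P.Edge s s → P.Edge s t → t = s) {V : ℕ → Prop} {R : ℕ → ℕ → ℕ → Prop}
    (hR : IsPathTable n I C U V R) (t : Trace AP) :
    t ∈ P.traces ↔ ∃ l < n, V l ∧ t = rowTrace n R L l := by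
  obtain ⟨⟨l₀, hl₀, hV₀⟩, hR⟩ := hR
  have htr : ∀ l < n, V l → ∀ p : ℕ → Fin n, (∀ i, R l (min i n) (p i)) → ∀ i,
      P.label (p i) = rowTrace n R L l i := by
    intro l hl hV p hp i
    obtain ⟨s, hs, hRs, hu⟩ := (hR l hl hV).1 (min i n) (by omega)
    ext a
    rw [← h.label]
    constructor
    · exact fun ha => ⟨p i, (p i).2, hp i, ha⟩
    · rintro ⟨s', hs', hRs', ha⟩
      rwa [hu _ (p i).2 (hp i), ← hu _ hs' hRs']
  constructor
  · rintro ⟨p, ⟨h0, hp⟩, ht⟩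
    -- Any row starts correctly, since all rows start in the initial state; the deviation clause
    -- then extends the agreement by one time step.
    have key : ∀ i ≤ n, ∃ l < n, V l ∧ ∀ j ≤ i, R l j (p j) := by
      intro i
      induction i with
      | zero =>
        intro _
        obtain ⟨s, hs, hRs, -⟩ := (hR l₀ hl₀ hV₀).1 0 (by omega)
        refine ⟨l₀, hl₀, hV₀, fun j hj => ?_⟩
        have := (h.init ⟨s, hs⟩).mp ((hR l₀ hl₀ hV₀).2.1 s hs hRs)
        rw [Nat.le_zero.mp hj, h0, ← this]
        exact hRs
      | succ i ih =>
        intro hi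
        obtain ⟨l, hl, hV, hRl⟩ := ih (by omega)
        obtain ⟨l', hl', hV', hR', hagree⟩ := (hR l hl hV).2.2.2.2 i (by omega) (p i) (p i).2
          (hRl i le_rfl) (p (i + 1)) (p (i + 1)).2 ((h.step _ _).mpr (hp i))
        refine ⟨l', hl', hV', fun j hj => ?_⟩
        rcases Nat.le_succ_iff.mp hj with hj | rfl
        · exact hagree j (by omega) _ (p j).2 (hRl j hj)
        · exact hR'
    obtain ⟨l, hl, hV, hRl⟩ := key n le_rfl
    have hself : P.Edge (p n) (p n) :=
      (h.step _ _).mp ((hR l hl hV).2.2.2.1 (p n) (p n).2 (hRl n le_rfl))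
    have hstay : ∀ k, p (n + k) = p n := by
      intro k
      induction k with
      | zero => rfl
      | succ k ih => exact hloop _ _ hself (by have := hp (n + k); rwa [ih] at this)
    refine ⟨l, hl, hV, funext fun i => (ht i).trans (htr l hl hV p (fun i => ?_) i)⟩
    rcases le_total i n with hi | hi
    · rw [min_eq_left hi]; exact hRl i hi
    · rw [min_eq_right hi, ← Nat.add_sub_cancel' hi, hstay]; exact hRl n le_rfl
  · rintro ⟨l, hl, hV, rfl⟩
    obtain ⟨hfun, hinit, hstep, hend, -⟩ := hR l hl hV
    choose p hpn hpR _ using fun i => hfun (min i n) (by omega)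
    refine ⟨fun i => ⟨p i, hpn i⟩, ⟨?_, fun i => ?_⟩, fun i =>
      (htr l hl hV (fun i => ⟨p i, hpn i⟩) hpR i).symm⟩
    · have := hpR 0
      rw [Nat.zero_min] at this
      exact (h.init ⟨p 0, hpn 0⟩).mp (hinit _ (hpn 0) this)
    · refine (h.step _ _).mp ?_
      have h1 := hpR i
      have h2 := hpR (i + 1)
      rcases lt_or_ge i n with hi | hi
      · rw [min_eq_left hi.le] at h1
        rw [min_eq_left hi] at h2
        exact hstep i hi _ (hpn i) h1 _ (hpn (i + 1)) h2
      · rw [min_eq_right hi] at h1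
        rw [min_eq_right (by omega)] at h2
        obtain ⟨s, -, -, hu⟩ := hfun n (by omega)
        have e : p (i + 1) = p i := (hu _ (hpn _) h2).trans (hu _ (hpn _) h1).symm
        change Step C U (p i) (p (i + 1))
        rw [e]
        exact hend _ (hpn i) h1

/-- Some path of the plant is in state `l` at time `n`. -/
def PathEnd (P : Plant AP (Fin n)) (l : ℕ) : Prop := ∃ p, P.IsPath p ∧ (p n : ℕ) = l

/-- Some path of the plant that is in state `l` at time `n` is in state `s` at time `i`. -/
def PathTable (P : Plant AP (Fin n)) (l i s : ℕ) : Prop :=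
  ∃ p, P.IsPath p ∧ (p n : ℕ) = l ∧ (p i : ℕ) = s

/-- The paths of a plant whose edges are among those of a tree-shaped plant form a path table. -/
theorem DescribedBy.isPathTable (h : P.DescribedBy I C U L) {P₀ : Plant AP (Fin n)}
    (hP : P₀.TreeShaped) (hE : ∀ s t, P.Edge s t → P₀.Edge s t) :
    IsPathTable n I C U P.PathEnd P.PathTable := by
  obtain ⟨hend, huniq⟩ := hP.paths
  have hedge : ∀ p, P.IsPath p → ∀ i, P₀.Edge (p i) (p (i + 1)) := fun p hp i => hE _ _ (hp.2 i)
  have huniq' : ∀ p q, P.IsPath p → P.IsPath q → (p n : ℕ) = q n → ∀ i ≤ n, p i = q i :=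
    fun p q hp hq he => huniq p q (hedge p hp) (hedge q hq) (hp.1.trans hq.1.symm) n (Fin.ext he)
  have hext : ∀ s, ∃ p : ℕ → Fin n, p 0 = s ∧ ∀ i, P.Edge (p i) (p (i + 1)) := by
    intro s
    choose f hf using P.total
    refine ⟨fun i => f^[i] s, rfl, fun i => ?_⟩
    change P.Edge (f^[i] s) (f^[i + 1] s)
    rw [Function.iterate_succ_apply']
    exact hf _
  constructor
  · obtain ⟨p, hp0, hp⟩ := hext P.init
    exact ⟨p n, (p n).2, p, ⟨hp0, hp⟩, rfl⟩
  rintro l - ⟨p, hp, rfl⟩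
  refine ⟨fun i hi => ⟨p i, (p i).2, ⟨p, hp, rfl, rfl⟩, ?_⟩, ?_, ?_, ?_, ?_⟩
  · rintro t - ⟨q, hq, hqn, rfl⟩
    rw [huniq' q p hq hp hqn i (by omega)]
  · rintro s - ⟨q, hq, hqn, rfl⟩
    exact (h.init _).mpr hq.1
  · rintro i hi s - ⟨q, hq, hqn, rfl⟩ t - ⟨q', hq', hqn', rfl⟩
    rw [huniq' q' q hq' hq (hqn'.trans hqn.symm) (i + 1) hi]
    exact (h.step _ _).mpr (hq.2 i)
  · rintro s - ⟨q, hq, hqn, rfl⟩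
    have := hq.2 n
    rw [hend q (hedge q hq)] at this
    exact (h.step _ _).mpr this
  · rintro i hi s - ⟨q, hq, hqn, rfl⟩ t ht hst
    obtain ⟨r, hr0, hr⟩ := hext ⟨t, ht⟩
    -- The deviating path follows `q` up to time `i`, steps to `t` and continues arbitrarily; its
    -- state at time `n` names the row required.
    set p' : ℕ → Fin n := fun j => if j ≤ i then q j else r (j - (i + 1)) with hp'
    have hpath : P.IsPath p' := by
      refine ⟨by simpa [hp'] using hq.1, fun j => ?_⟩
      rcases lt_trichotomy j i with hj | rfl | hj
      · simp only [hp', if_pos hj.le, if_pos (Nat.succ_le_of_lt hj)]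
        exact hq.2 j
      · simp only [hp', le_refl, if_true, if_neg (Nat.not_succ_le_self j), Nat.sub_self, hr0]
        exact (h.step _ ⟨t, ht⟩).mp hst
      · simp only [hp', if_neg (Nat.not_le_of_lt hj), if_neg (Nat.not_le_of_lt (Nat.lt_succ_of_lt hj))]
        rw [show j + 1 - (i + 1) = j - (i + 1) + 1 by omega]
        exact hr _
    refine ⟨p' n, (p' n).2, ⟨p', hpath, rfl⟩, ⟨p', hpath, rfl, ?_⟩, ?_⟩
    · simp [hp', hr0]
    · rintro j hj u - ⟨q', hq', hqn', rfl⟩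
      refine ⟨p', hpath, rfl, ?_⟩
      simp only [hp', if_pos (Nat.le_of_lt_succ hj)]
      rw [huniq' q q' hq hq' (hqn.trans hqn'.symm) j (by omega)]

theorem TreeShaped.eq_of_selfLoop (hP : P.TreeShaped) {s t : Fin n} (hs : P.Edge s s)
    (ht : P.Edge s t) : t = s :=
  let ⟨_, _, _, _, hloop⟩ := hP
  hloop s t hs ht

theorem DescribedBy.models_iff (h : P.DescribedBy I C U L)
    (hloop : ∀ s t, P.Edge s s → P.Edge s t → t = s) {V : ℕ → Prop} {R : ℕ → ℕ → ℕ → Prop}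
    (hR : IsPathTable n I C U V R) (φ : HyperLTL AP) :
    P.Models φ ↔ φ.Holds n V R L fun _ => none :=
  (HyperLTL.holds_iff n V R L φ P.traces (h.mem_traces_iff hloop hR) fun _ => none).symm

/-- A restriction with a path table that satisfies the formula is a controller. -/
theorem DescribedBy.hasController (h : P.DescribedBy I C U L) (hP : P.TreeShaped)
    {φ : HyperLTL AP} {C' : ℕ → ℕ → Prop} {V : ℕ → Prop} {R : ℕ → ℕ → ℕ → Prop}
    (hC' : IsRestriction n C U C') (hR : IsPathTable n I C' U V R)
    (hφ : φ.Holds n V R L fun _ => none) : P.HasController φ := by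
  obtain ⟨hC', htot⟩ := hC'
  let P' : Plant AP (Fin n) :=
    { init := P.init
      ctrl := fun s t => C' s t
      unctrl := P.unctrl
      label := P.label
      disjoint := fun s t hst => P.disjoint s t
        ⟨(h.ctrl s t).mp (hC' s s.2 t t.2 hst.1), hst.2⟩
      total := fun s => by
        obtain ⟨t, ht, hst⟩ := htot s s.2
        exact ⟨⟨t, ht⟩, hst.imp id (h.unctrl s ⟨t, ht⟩).mp⟩ }
  have hctrl : ∀ s t, P'.ctrl s t → P.ctrl s t := fun s t hst =>
    (h.ctrl s t).mp (hC' s s.2 t t.2 hst)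
  have hE : ∀ s t, P'.Edge s t → P.Edge s t := fun s t => Or.imp (hctrl s t) id
  have h' : P'.DescribedBy I C' U L := ⟨h.init, fun s t => Iff.rfl, h.unctrl, h.label⟩
  exact ⟨P', rfl, hctrl, fun _ _ => Iff.rfl, fun _ => rfl,
    (h'.models_iff (fun s t hs hst => hP.eq_of_selfLoop (hE _ _ hs) (hE _ _ hst)) hR φ).mpr hφ⟩

end Plant

/-! ## Definability of certificates -/

/-- The bit of a word at a position is set. -/
def bitAt (w : List Bool) (i : ℕ) : Prop := w[i]? = some true

/-- The position in the description of a plant where the block of a state begins. -/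
def blockPos (m n s : ℕ) : ℕ := n + 1 + s * (1 + m + 2 * n)

/-- The initial states according to the description of a plant. -/
def initBit (m : ℕ) (w : List Bool) (n s : ℕ) : Prop := bitAt w (blockPos m n s)

/-- The labels according to the description of a plant. -/
def labelBit (m : ℕ) (w : List Bool) (n s a : ℕ) : Prop := bitAt w (blockPos m n s + (1 + a))

/-- The controllable transitions according to the description of a plant. -/
def ctrlBit (m : ℕ) (w : List Bool) (n s t : ℕ) : Prop :=
  bitAt w (blockPos m n s + (1 + m + 2 * t))

/-- The uncontrollable transitions according to the description of a plant. -/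
def unctrlBit (m : ℕ) (w : List Bool) (n s t : ℕ) : Prop :=
  bitAt w (blockPos m n s + (1 + m + 2 * t + 1))

/-- The bits of a certificate, which hold a relation of arity four. -/
def certBit (c : List Bool) (n k l i s : ℕ) : Prop :=
  bitAt c (((k * (n + 4) + l) * (n + 4) + i) * (n + 4) + s)

/-- The word has the shape of the description of a plant with `n` states. -/
def IsPlantWord (m : ℕ) (w : List Bool) (n : ℕ) : Prop :=
  w.length = n + 1 + n * (1 + m + 2 * n) ∧ (∀ i < n, bitAt w i) ∧ ¬ bitAt w n ∧
  (∃ s₀ < n, ∀ s < n, initBit m w n s ↔ s = s₀) ∧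
  (∀ s < n, ∀ t < n, ¬ (ctrlBit m w n s t ∧ unctrlBit m w n s t)) ∧
  ∀ s < n, ∃ t < n, Step (ctrlBit m w n) (unctrlBit m w n) s t

/-- The certificate `x.2` shows that the word `x.1` is in the language for `φ`. -/
def Verified {AP : Type*} {m : ℕ} (e : Fin m ≃ AP) (φ : HyperLTL AP)
    (x : List Bool × List Bool) : Prop :=
  -- The first index of `certBit` selects the relation: 0 the tree order, 1 the kept transitions, 2
  -- the rows in use, 3 the path table. Superfluous indices are 0.
  ∃ n < x.1.length, IsPlantWord m x.1 n ∧
    IsTree n (ctrlBit m x.1 n) (unctrlBit m x.1 n) (certBit x.2 n 0 0) ∧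
    IsRestriction n (ctrlBit m x.1 n) (unctrlBit m x.1 n) (certBit x.2 n 1 0) ∧
    IsPathTable n (initBit m x.1 n) (certBit x.2 n 1 0) (unctrlBit m x.1 n)
      (certBit x.2 n 2 0 0) (certBit x.2 n 3) ∧
    φ.Holds n (certBit x.2 n 2 0 0) (certBit x.2 n 3)
      (fun s a => labelBit m x.1 n s (e.symm a)) fun _ => none

section

variable {α : Type} [Ctx α]

/-- The function that returns the input words of a context. -/
def IsInput (x : α → List Bool × List Bool) : Prop := ∀ a, x a = Ctx.input a

theorem IsInput.fst {x : α → List Bool × List Bool} (hx : IsInput x) :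
    IsInput fun a : α × ℕ => x a.1 :=
  fun a => hx a.1

variable {m : ℕ} {x : α → List Bool × List Bool} {n k l i s t : α → ℕ}

theorem FO.bitAt_fst (hx : IsInput x) (hi : Tm i) : FO fun a => bitAt (x a).1 (i a) :=
  (FO.bit_fst hi).of_iff fun a => by rw [bitAt, hx]

theorem FO.bitAt_snd (hx : IsInput x) (hi : Tm i) : FO fun a => bitAt (x a).2 (i a) :=
  (FO.bit_snd hi).of_iff fun a => by rw [bitAt, hx]

theorem Tm.length_input (hx : IsInput x) : Tm fun a => (x a).1.length := by
  have : x = Ctx.input := funext hx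
  subst this
  exact Tm.length_fst

theorem Tm.blockPos (m : ℕ) (hn : Tm n) (hs : Tm s) : Tm fun a => blockPos m (n a) (s a) :=
  (hn.add (.const 1)).add (hs.mul (((Tm.const 1).add (.const m)).add ((Tm.const 2).mul hn)))

theorem fo_initBit (hx : IsInput x) (hn : Tm n) (hs : Tm s) :
    FO fun a => initBit m (x a).1 (n a) (s a) :=
  FO.bitAt_fst hx (hn.blockPos m hs)

theorem fo_labelBit (hx : IsInput x) (hn : Tm n) (hs : Tm s) (b : ℕ) :
    FO fun a => labelBit m (x a).1 (n a) (s a) b :=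
  FO.bitAt_fst hx ((hn.blockPos m hs).add ((Tm.const 1).add (.const b)))

theorem fo_ctrlBit (hx : IsInput x) (hn : Tm n) (hs : Tm s) (ht : Tm t) :
    FO fun a => ctrlBit m (x a).1 (n a) (s a) (t a) :=
  FO.bitAt_fst hx ((hn.blockPos m hs).add
    (((Tm.const 1).add (.const m)).add ((Tm.const 2).mul ht)))

theorem fo_unctrlBit (hx : IsInput x) (hn : Tm n) (hs : Tm s) (ht : Tm t) :
    FO fun a => unctrlBit m (x a).1 (n a) (s a) (t a) :=
  FO.bitAt_fst hx ((hn.blockPos m hs).add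
    ((((Tm.const 1).add (.const m)).add ((Tm.const 2).mul ht)).add (.const 1)))

theorem fo_certBit (hx : IsInput x) (hn : Tm n) (k : ℕ) (hl : Tm l) (hi : Tm i) (hs : Tm s) :
    FO fun a => certBit (x a).2 (n a) k (l a) (i a) (s a) :=
  have hM := hn.add (.const 4)
  FO.bitAt_snd hx ((((((Tm.const k).mul hM).add hl).mul hM).add hi).mul hM |>.add hs)

theorem fo_step_ctrlBit (hx : IsInput x) (hn : Tm n) (hs : Tm s) (ht : Tm t) :
    FO fun a => Step (ctrlBit m (x a).1 (n a)) (unctrlBit m (x a).1 (n a)) (s a) (t a) :=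
  (fo_ctrlBit hx hn hs ht).or (fo_unctrlBit hx hn hs ht)

theorem fo_step_certBit (hx : IsInput x) (hn : Tm n) (hs : Tm s) (ht : Tm t) :
    FO fun a => Step (certBit (x a).2 (n a) 1 0) (unctrlBit m (x a).1 (n a)) (s a) (t a) :=
  (fo_certBit hx hn 1 (.const 0) hs ht).or (fo_unctrlBit hx hn hs ht)

theorem fo_isPlantWord (hx : IsInput x) (hn : Tm n) :
    FO fun a => IsPlantWord m (x a).1 (n a) := by
  have hx₁ := hx.fst
  have hx₂ := hx₁.fst
  have hn₁ := hn.fst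
  have hn₂ := hn₁.fst
  refine .and (.eq (.length_input hx) ((hn.add (.const 1)).add
    (hn.mul (((Tm.const 1).add (.const m)).add ((Tm.const 2).mul hn))))) (.and ?_ (.and ?_ (.and ?_
      (.and ?_ ?_))))
  · exact .all hn (.bitAt_fst hx₁ .snd)
  · exact .not (.bitAt_fst hx hn)
  · exact .ex hn (.all hn₁ (.iff (fo_initBit hx₂ hn₂ .snd) (.eq .snd Tm.snd.fst)))
  · exact .all hn (.all hn₁ (.not (.and (fo_ctrlBit hx₂ hn₂ Tm.snd.fst .snd)
      (fo_unctrlBit hx₂ hn₂ Tm.snd.fst .snd))))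
  · exact .all hn (.ex hn₁ (fo_step_ctrlBit hx₂ hn₂ Tm.snd.fst .snd))

theorem fo_isTree (hx : IsInput x) (hn : Tm n) :
    FO fun a => IsTree (n a) (ctrlBit m (x a).1 (n a)) (unctrlBit m (x a).1 (n a))
      (certBit (x a).2 (n a) 0 0) := by
  have hx₁ := hx.fst
  have hx₂ := hx₁.fst
  have hx₃ := hx₂.fst
  have hx₄ := hx₃.fst
  have hn₁ := hn.fst
  have hn₂ := hn₁.fst
  have hn₃ := hn₂.fst
  have hn₄ := hn₃.fst
  refine .and ?_ (.and ?_ (.and ?_ ?_))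
  · exact .all hn (.not (fo_certBit hx₁ hn₁ 0 (.const 0) .snd .snd))
  · exact .all hn (.all hn₁ (.all hn₂ (.imp (fo_certBit hx₃ hn₃ 0 (.const 0) Tm.snd.fst.fst Tm.snd.fst)
      (.imp (fo_certBit hx₃ hn₃ 0 (.const 0) Tm.snd.fst .snd)
        (fo_certBit hx₃ hn₃ 0 (.const 0) Tm.snd.fst.fst .snd)))))
  · exact .all hn (.all hn₁ (.imp (fo_step_ctrlBit hx₂ hn₂ Tm.snd.fst Tm.snd.fst)
      (.imp (fo_step_ctrlBit hx₂ hn₂ Tm.snd.fst .snd) (.eq .snd Tm.snd.fst))))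
  · refine .ex hn (.and (.all hn₁ (.imp (fo_step_ctrlBit hx₂ hn₂ .snd Tm.snd.fst)
      (.eq .snd Tm.snd.fst))) (.all hn₁ (.imp (.ne .snd Tm.snd.fst) (.ex hn₂ (.and ?_ (.and ?_
        (.and ?_ (.all hn₃ (.imp ?_ (.imp ?_ ?_))))))))))
    · exact .ne .snd Tm.snd.fst
    · exact fo_step_ctrlBit hx₃ hn₃ .snd Tm.snd.fst
    · exact fo_certBit hx₃ hn₃ 0 (.const 0) .snd Tm.snd.fst
    · exact .ne .snd Tm.snd.fst.fst
    · exact fo_step_ctrlBit hx₄ hn₄ .snd Tm.snd.fst.fst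
    · exact .eq .snd Tm.snd.fst

theorem fo_isRestriction (hx : IsInput x) (hn : Tm n) :
    FO fun a => IsRestriction (n a) (ctrlBit m (x a).1 (n a))
      (unctrlBit m (x a).1 (n a)) (certBit (x a).2 (n a) 1 0) := by
  have hx₂ := hx.fst.fst
  have hn₁ := hn.fst
  have hn₂ := hn₁.fst
  exact .and (.all hn (.all hn₁ (.imp (fo_certBit hx₂ hn₂ 1 (.const 0) Tm.snd.fst .snd)
    (fo_ctrlBit hx₂ hn₂ Tm.snd.fst .snd)))) (.all hn (.ex hn₁ (fo_step_certBit hx₂ hn₂ Tm.snd.fst .snd)))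

theorem fo_isPathTable (hx : IsInput x) (hn : Tm n) :
    FO fun a => IsPathTable (n a) (initBit m (x a).1 (n a))
      (certBit (x a).2 (n a) 1 0) (unctrlBit m (x a).1 (n a))
      (certBit (x a).2 (n a) 2 0 0) (certBit (x a).2 (n a) 3) := by
  have hx₁ := hx.fst
  have hx₂ := hx₁.fst
  have hx₃ := hx₂.fst
  have hx₄ := hx₃.fst
  have hx₅ := hx₄.fst
  have hx₇ := hx₅.fst.fst
  have hn₁ := hn.fst
  have hn₂ := hn₁.fst
  have hn₃ := hn₂.fst
  have hn₄ := hn₃.fst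
  have hn₅ := hn₄.fst
  have hn₆ := hn₅.fst
  have hn₇ := hn₆.fst
  have hV : FO fun a : α × ℕ => certBit (x a.1).2 (n a.1) 2 0 0 a.2 :=
    fo_certBit hx₁ hn₁ 2 (.const 0) (.const 0) .snd
  refine .and (.ex hn hV) (.all hn (.imp hV (.and ?_ (.and ?_ (.and ?_ (.and ?_ ?_))))))
  · exact .all (hn₁.add (.const 1)) (.ex hn₂ (.and
      (fo_certBit hx₃ hn₃ 3 Tm.snd.fst.fst Tm.snd.fst .snd) (.all hn₃ (.imp
        (fo_certBit hx₄ hn₄ 3 Tm.snd.fst.fst.fst Tm.snd.fst.fst .snd) (.eq .snd Tm.snd.fst)))))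
  · exact .all hn₁ (.imp (fo_certBit hx₂ hn₂ 3 Tm.snd.fst (.const 0) .snd) (fo_initBit hx₂ hn₂ .snd))
  · exact .all hn₁ (.all hn₂ (.imp (fo_certBit hx₃ hn₃ 3 Tm.snd.fst.fst Tm.snd.fst .snd)
      (.all hn₃ (.imp (fo_certBit hx₄ hn₄ 3 Tm.snd.fst.fst.fst (Tm.snd.fst.fst.add (.const 1)) .snd)
        (fo_step_certBit hx₄ hn₄ Tm.snd.fst .snd)))))
  · exact .all hn₁ (.imp (fo_certBit hx₂ hn₂ 3 Tm.snd.fst hn₂ .snd)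
      (fo_step_certBit hx₂ hn₂ .snd .snd))
  · refine .all hn₁ (.all hn₂ (.imp (fo_certBit hx₃ hn₃ 3 Tm.snd.fst.fst Tm.snd.fst .snd)
      (.all hn₃ (.imp (fo_step_certBit hx₄ hn₄ Tm.snd.fst .snd) (.ex hn₄ (.and ?_ (.and ?_ ?_)))))))
    · exact fo_certBit hx₅ hn₅ 2 (.const 0) (.const 0) .snd
    · exact fo_certBit hx₅ hn₅ 3 .snd (Tm.snd.fst.fst.fst.add (.const 1)) Tm.snd.fst
    · exact .all (Tm.snd.fst.fst.fst.add (.const 1)) (.all hn₆ (.imp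
        (fo_certBit hx₇ hn₇ 3 Tm.snd.fst.fst.fst.fst.fst.fst Tm.snd.fst .snd)
        (fo_certBit hx₇ hn₇ 3 Tm.snd.fst.fst Tm.snd.fst .snd)))

end

/-- Trace variables are assigned terms instead of numbers, because row indices are themselves
quantified variables of the context. The context is generalized, as the until operator binds two
more numbers. -/
theorem fo_ltlHolds {AP : Type*} {m : ℕ} (e : Fin m ≃ AP) (ψ : LTLBody AP) {α : Type} [Ctx α]
    {x : α → List Bool × List Bool} {n q : α → ℕ} (hx : IsInput x) (hn : Tm n) (hq : Tm q)
    (ρ : ℕ → Option (α → ℕ)) (hρ : ∀ y f, ρ y = some f → Tm f) :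
    FO fun a => ψ.Holds (n a) (certBit (x a).2 (n a) 3)
      (fun s b => labelBit m (x a).1 (n a) s (e.symm b))
      (fun y => (ρ y).map fun f => f a) (q a) := by
  induction ψ generalizing α with
  | tt => exact fo_true
  | atom b y =>
    rcases hy : ρ y with _ | f
    · exact fo_false.of_iff fun a => by simp [LTLBody.Holds, hy]
    · refine (FO.ex hn (P := fun a s => certBit (x a).2 (n a) 3 (f a) (q a) s ∧
        labelBit m (x a).1 (n a) s (e.symm b)) (.and (fo_certBit hx.fst hn.fst 3
          (hρ y f hy).fst hq.fst .snd) (fo_labelBit hx.fst hn.fst .snd _))).of_iff fun a => ?_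
      simp [LTLBody.Holds, hy]
  | neg ψ ih => exact .not (ih hx hn hq ρ hρ)
  | or ψ₁ ψ₂ ih₁ ih₂ => exact .or (ih₁ hx hn hq ρ hρ) (ih₂ hx hn hq ρ hρ)
  | untl ψ₁ ψ₂ ih₁ ih₂ =>
    have h₁ := ih₁ (α := (α × ℕ) × ℕ) hx.fst.fst hn.fst.fst .snd
      (fun y => (ρ y).map fun f a => f a.1.1) (fun y g hg => by
        obtain ⟨f, hf, rfl⟩ := Option.map_eq_some_iff.mp hg
        exact (hρ y f hf).fst.fst)
    have h₂ := ih₂ (α := α × ℕ) hx.fst hn.fst .snd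
      (fun y => (ρ y).map fun f a => f a.1) (fun y g hg => by
        obtain ⟨f, hf, rfl⟩ := Option.map_eq_some_iff.mp hg
        exact (hρ y f hf).fst)
    simp only [Option.map_map, Function.comp_def] at h₁ h₂
    exact .ex (hn.add (.const 1)) (.and (.le hq.fst .snd) (.and h₂
      (.all .snd (.imp (.le hq.fst.fst .snd) h₁))))
  | next ψ ih =>
    exact .or (.and (.lt hq hn) (ih hx hn (hq.add (.const 1)) ρ hρ))
      (.and (.not (.lt hq hn)) (ih hx hn hq ρ hρ))

/-- A trace quantifier binds a new row index, so its variable is assigned the projection to the last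
component of the extended context. -/
theorem fo_update {α : Type} [Ctx α] {P : α → (ℕ → Option ℕ) → Prop} (ρ : ℕ → Option (α → ℕ))
    (hρ : ∀ y f, ρ y = some f → Tm f) (y : ℕ)
    (h : ∀ ρ' : ℕ → Option (α × ℕ → ℕ), (∀ y f, ρ' y = some f → Tm f) →
      FO fun a : α × ℕ => P a.1 fun z => (ρ' z).map fun f => f a) :
    FO fun a : α × ℕ => P a.1 (Function.update (fun z => (ρ z).map fun f => f a.1) y (some a.2)) := by
  refine (h (Function.update (fun z => (ρ z).map fun f a => f a.1) y (some Prod.snd))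
    fun z g hg => ?_).of_iff fun a => ?_
  · by_cases hz : z = y
    · subst hz
      rw [Function.update_self, Option.some_inj] at hg
      subst hg
      exact .snd
    · rw [Function.update_of_ne hz] at hg
      obtain ⟨f, hf, rfl⟩ := Option.map_eq_some_iff.mp hg
      exact (hρ z f hf).fst
  · refine iff_of_eq (congrArg _ (funext fun z => ?_))
    by_cases hz : z = y
    · subst hz; simp
    · simp [hz, Function.comp_def]

/-- Each trace quantifier becomes one loop over rows. The recursion is on the fixed formula, so the
number of nested loops does not depend on the input. -/
theorem fo_hyperLTLHolds {AP : Type*} {m : ℕ} (e : Fin m ≃ AP) (φ : HyperLTL AP) {α : Type} [Ctx α]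
    {x : α → List Bool × List Bool} {n : α → ℕ} (hx : IsInput x) (hn : Tm n)
    (ρ : ℕ → Option (α → ℕ)) (hρ : ∀ y f, ρ y = some f → Tm f) :
    FO fun a => φ.Holds (n a) (certBit (x a).2 (n a) 2 0 0) (certBit (x a).2 (n a) 3)
      (fun s b => labelBit m (x a).1 (n a) s (e.symm b))
      (fun y => (ρ y).map fun f => f a) := by
  induction φ generalizing α with
  | ex y φ ih =>
    exact .ex hn (.and (fo_certBit hx.fst hn.fst 2 (.const 0) (.const 0) .snd)
      (fo_update (P := fun a ρ => φ.Holds (n a) (certBit (x a).2 (n a) 2 0 0)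
        (certBit (x a).2 (n a) 3) (fun s b => labelBit m (x a).1 (n a) s (e.symm b)) ρ) ρ hρ y (ih hx.fst hn.fst)))
  | all y φ ih =>
    exact .all hn (.imp (fo_certBit hx.fst hn.fst 2 (.const 0) (.const 0) .snd)
      (fo_update (P := fun a ρ => φ.Holds (n a) (certBit (x a).2 (n a) 2 0 0)
        (certBit (x a).2 (n a) 3) (fun s b => labelBit m (x a).1 (n a) s (e.symm b)) ρ) ρ hρ y (ih hx.fst hn.fst)))
  | body ψ => exact fo_ltlHolds e ψ hx hn (.const 0) ρ hρ

theorem fo_verified {AP : Type*} {m : ℕ} (e : Fin m ≃ AP) (φ : HyperLTL AP) :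
    FO (Verified e φ) := by
  have hx : IsInput fun x : List Bool × List Bool => x := fun _ => rfl
  refine .ex (.length_input hx) (.and (fo_isPlantWord hx.fst .snd) (.and (fo_isTree hx.fst .snd)
    (.and (fo_isRestriction hx.fst .snd) (.and (fo_isPathTable hx.fst .snd) ?_))))
  exact fo_hyperLTLHolds e φ hx.fst .snd (fun _ => none) fun _ _ h => by simp at h

/-! ## Descriptions of plants as words -/

theorem List.getElem?_flatMap_of_length {α β : Type*} (f : α → List β) {b : ℕ}
    (hf : ∀ x, (f x).length = b) (l : List α) {s j : ℕ} (hs : s < l.length) (hj : j < b) :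
    (l.flatMap f)[s * b + j]? = (f l[s])[j]? := by
  induction l generalizing s with
  | nil => simp at hs
  | cons x l ih =>
    rw [List.flatMap_cons]
    rcases s with _ | s
    · rw [List.getElem?_append_left (by rw [hf]; omega)]
      simp
    · rw [List.getElem?_append_right (by rw [hf, Nat.succ_mul]; omega), hf,
        show (s + 1) * b + j - b = s * b + j by rw [Nat.succ_mul]; omega,
        ih (by simpa using hs)]
      simp

namespace Plant

variable {AP : Type*} {m n : ℕ}

open Classical in
/-- The block of a state in the description of a plant. -/
theorem getElem?_encode (e : Fin m ≃ AP) (P : Plant AP (Fin n)) (s : Fin n) {j : ℕ}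
    (hj : j < 1 + m + 2 * n) : (P.encode e)[blockPos m n s + j]? =
      ((decide (s = P.init) :: ((List.finRange m).map fun a => decide (e a ∈ P.label s))) ++
      (List.finRange n).flatMap fun t => [decide (P.ctrl s t), decide (P.unctrl s t)])[j]? := by
  have hblock : ∀ s : Fin n, ((decide (s = P.init) ::
      ((List.finRange m).map fun a => decide (e a ∈ P.label s))) ++ (List.finRange n).flatMap
        fun t => [decide (P.ctrl s t), decide (P.unctrl s t)]).length = 1 + m + 2 * n := by
    intro s
    simp [List.length_flatMap, List.map_const', Nat.mul_comm]
    ring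
  have h := List.getElem?_flatMap_of_length _ hblock (List.finRange n) (s := s) (j := j)
    (by simp) hj
  rw [encode, List.append_cons, List.getElem?_append_right (by simp [blockPos]; omega)]
  have hpos : blockPos m n s + j - (List.replicate n true ++ [false]).length =
      s * (1 + m + 2 * n) + j := by simp [blockPos]; omega
  rw [hpos, h]
  simp

theorem describedBy_encode (e : Fin m ≃ AP) (P : Plant AP (Fin n)) :
    P.DescribedBy (initBit m (P.encode e) n) (ctrlBit m (P.encode e) n)
      (unctrlBit m (P.encode e) n) fun s a => labelBit m (P.encode e) n s (e.symm a) := by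
  classical
  refine ⟨fun s => ?_, fun s t => ?_, fun s t => ?_, fun s a => ?_⟩
  · have h := P.getElem?_encode e s (j := 0) (by omega)
    rw [initBit, bitAt, ← Nat.add_zero (blockPos m n s), h]
    simp
  · have h := P.getElem?_encode e s (j := 1 + m + 2 * t) (by omega)
    have h' := List.getElem?_flatMap_of_length
      (fun t => [decide (P.ctrl s t), decide (P.unctrl s t)]) (b := 2) (fun _ => rfl)
      (List.finRange n) (s := t) (j := 0) (by simp) (by norm_num)
    rw [ctrlBit, bitAt, h, List.getElem?_append_right (by simp; omega)]
    rw [show 1 + m + 2 * (t : ℕ) - _ = t * 2 + 0 by simp; omega, h']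
    simp
  · have h := P.getElem?_encode e s (j := 1 + m + 2 * t + 1) (by omega)
    have h' := List.getElem?_flatMap_of_length
      (fun t => [decide (P.ctrl s t), decide (P.unctrl s t)]) (b := 2) (fun _ => rfl)
      (List.finRange n) (s := t) (j := 1) (by simp) (by norm_num)
    rw [unctrlBit, bitAt, h, List.getElem?_append_right (by simp; omega)]
    rw [show 1 + m + 2 * (t : ℕ) + 1 - _ = t * 2 + 1 by simp; omega, h']
    simp
  · have h := P.getElem?_encode e s (j := 1 + (e.symm a : ℕ)) (by omega)
    rw [labelBit, bitAt, h, List.getElem?_append_left (by simp; omega), Nat.add_comm 1]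
    simp

theorem isPlantWord_encode (e : Fin m ≃ AP) (P : Plant AP (Fin n)) :
    IsPlantWord m (P.encode e) n := by
  have h := P.describedBy_encode e
  refine ⟨P.length_encode e, fun i hi => ?_, ?_, ⟨P.init, P.init.2, fun s hs => ?_⟩,
    fun s hs t ht hst => ?_, fun s hs => ?_⟩
  · rw [bitAt, encode, List.getElem?_append_left (by simpa using hi)]
    simp [hi]
  · rw [bitAt, encode, List.getElem?_append_right (by simp)]
    simp
  · exact (h.init ⟨s, hs⟩).trans Fin.ext_iff
  · exact P.disjoint ⟨s, hs⟩ ⟨t, ht⟩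
      ⟨(h.ctrl ⟨s, hs⟩ ⟨t, ht⟩).mp hst.1, (h.unctrl ⟨s, hs⟩ ⟨t, ht⟩).mp hst.2⟩
  · obtain ⟨t, ht⟩ := P.total ⟨s, hs⟩
    exact ⟨t, t.2, (h.step ⟨s, hs⟩ t).mpr ht⟩

end Plant

theorem eq_of_bitAt_iff {w w' : List Bool} (hl : w.length = w'.length)
    (h : ∀ i < w.length, (bitAt w i ↔ bitAt w' i)) : w = w' := by
  refine List.ext_getElem hl fun i hi hi' => ?_
  have := h i hi
  rw [bitAt, bitAt, List.getElem?_eq_getElem hi, List.getElem?_eq_getElem hi', Option.some_inj,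
    Option.some_inj] at this
  exact Bool.eq_iff_iff.mpr this

/-- A word of the shape of a description describes a plant. -/
theorem IsPlantWord.exists_encode {AP : Type*} {m n : ℕ} {w : List Bool} (h : IsPlantWord m w n)
    (e : Fin m ≃ AP) : ∃ P : Plant AP (Fin n), w = P.encode e := by
  obtain ⟨hlen, hones, hsep, ⟨s₀, hs₀, hinit⟩, hdisj, htot⟩ := h
  let P : Plant AP (Fin n) :=
    { init := ⟨s₀, hs₀⟩
      ctrl := fun s t => ctrlBit m w n s t
      unctrl := fun s t => unctrlBit m w n s t
      label := fun s => {a | labelBit m w n s (e.symm a)}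
      disjoint := fun s t => hdisj s s.2 t t.2
      total := fun s => let ⟨t, ht, hst⟩ := htot s s.2; ⟨⟨t, ht⟩, hst⟩ }
  have hP := P.describedBy_encode e
  obtain ⟨hlen', hones', hsep', -⟩ := P.isPlantWord_encode e
  -- The plant was read off from the bits of `w`, and its encoding has the same bits at those
  -- places; the unary header is fixed by the number of states.
  refine ⟨P, eq_of_bitAt_iff (hlen.trans hlen'.symm) fun i hi => ?_⟩
  rcases lt_trichotomy i n with hin | rfl | hin
  · exact iff_of_true (hones i hin) (hones' i hin)
  · exact iff_of_false hsep hsep'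
  have hb : 0 < 1 + m + 2 * n := by omega
  -- Here `j` is the offset in the block of `s`: offset 0 is the initial bit, the next `m` are
  -- labels, and then the two kinds of transitions alternate.
  obtain ⟨s, j, hj, hk⟩ : ∃ s j, j < 1 + m + 2 * n ∧ i - (n + 1) = s * (1 + m + 2 * n) + j :=
    ⟨_, _, Nat.mod_lt _ hb, (Nat.div_add_mod' _ _).symm⟩
  have hs : s < n := by
    by_contra hs
    have := Nat.mul_le_mul_right (1 + m + 2 * n) (not_lt.mp hs)
    omega
  have hi' : i = blockPos m n s + j := by rw [blockPos]; omega
  subst hi'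
  rcases Nat.eq_zero_or_pos j with rfl | hj0
  · exact ((hinit s hs).trans
      (Fin.ext_iff (a := ⟨s, hs⟩) (b := ⟨s₀, hs₀⟩)).symm).trans (hP.init ⟨s, hs⟩).symm
  rcases Nat.lt_or_ge j (1 + m) with hjm | hjm
  · obtain ⟨a, rfl⟩ : ∃ a, j = 1 + a := ⟨j - 1, by omega⟩
    have ha : a < m := by omega
    have := hP.label ⟨s, hs⟩ (e ⟨a, ha⟩)
    rw [Equiv.symm_apply_apply] at this
    refine Iff.trans ?_ this.symm
    change _ ↔ labelBit m w n s (e.symm (e ⟨a, ha⟩))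
    rw [Equiv.symm_apply_apply]
    rfl
  · obtain ⟨t, ht | ht⟩ : ∃ t, j = 1 + m + 2 * t ∨ j = 1 + m + 2 * t + 1 :=
      ⟨(j - (1 + m)) / 2, by omega⟩
    · subst ht
      exact (hP.ctrl ⟨s, hs⟩ ⟨t, by omega⟩).symm
    · subst ht
      exact (hP.unctrl ⟨s, hs⟩ ⟨t, by omega⟩).symm

/-- Every relation of arity four is held by some certificate. -/
theorem exists_certBit (n : ℕ) (Q : ℕ → ℕ → ℕ → ℕ → Prop) : ∃ c : List Bool,
    c.length = (n + 4) ^ 4 ∧ ∀ k < n + 4, ∀ l < n + 4, ∀ i < n + 4, ∀ s < n + 4,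
      (certBit c n k l i s ↔ Q k l i s) := by
  classical
  set M := n + 4 with hM
  -- The arguments are the four digits of the position in base `M = n + 4`, which leaves room for
  -- the four relations and for the time `n`.
  refine ⟨(List.range (M ^ 4)).map fun j => decide
    (Q (j / M / M / M) (j / M / M % M) (j / M % M) (j % M)), by simp, ?_⟩
  intro k hk l hl i hi s hs
  have hlt : ∀ {x y N : ℕ}, x < N → y < M → x * M + y < N * M := fun {x y N} hx hy => by
    have := Nat.mul_le_mul_right M (Nat.succ_le_of_lt hx)
    rw [Nat.succ_mul] at this
    omega
  have hdiv : ∀ x {y}, y < M → (x * M + y) / M = x := fun x y hy => by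
    rw [Nat.mul_comm, Nat.mul_add_div (by omega), Nat.div_eq_of_lt hy, Nat.add_zero]
  have hmod : ∀ x {y}, y < M → (x * M + y) % M = y := fun x y hy => by
    rw [Nat.mul_comm, Nat.mul_add_mod, Nat.mod_eq_of_lt hy]
  have hpos : ((k * M + l) * M + i) * M + s < M ^ 4 := by
    have := hlt (hlt (hlt hk hl) hi) hs
    calc _ < M * M * M * M := this
      _ = M ^ 4 := by ring
  rw [certBit, bitAt, ← hM, List.getElem?_map, List.getElem?_range hpos]
  simp only [Option.map_some, Option.some_inj, decide_eq_true_eq]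
  rw [hdiv _ hs, hdiv _ hi, hdiv _ hl, hmod _ hs, hmod _ hi, hmod _ hl]

/-! ### Soundness and completeness of certificates -/

theorem mem_treeSynthesis_of_verified {AP : Type*} {m : ℕ} (e : Fin m ≃ AP) (φ : HyperLTL AP)
    {w c : List Bool} (h : Verified e φ (w, c)) : w ∈ treeSynthesis e φ := by
  obtain ⟨n, -, hw, hT, hC, hR, hφ⟩ := h
  obtain ⟨P, rfl⟩ := hw.exists_encode e
  have hP := P.describedBy_encode e
  have hTS := hP.treeShaped hT
  exact ⟨n, P, hTS, hP.hasController hTS hC hR hφ, rfl⟩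

/-- The certificate stores an order of the tree, the controllable transitions that the controller
keeps, and the paths of the controlled plant, indexed by their states at time `n`. -/
theorem exists_verified {AP : Type*} {m : ℕ} (e : Fin m ≃ AP) (φ : HyperLTL AP)
    {w : List Bool} (h : w ∈ treeSynthesis e φ) :
    ∃ c : List Bool, c.length ≤ (w.length + 4) ^ 4 ∧ Verified e φ (w, c) := by
  obtain ⟨n, P, hTS, ⟨P', hinit, hctrl, hunctrl, hlabel, hφ⟩, rfl⟩ := h
  have hP := P.describedBy_encode e
  obtain ⟨O, hO⟩ := hP.exists_isTree hTS
  obtain ⟨c, hc, hQ⟩ := exists_certBit n fun k l i s =>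
    k = 0 ∧ O i s ∨ k = 1 ∧ (∃ (hi : i < n) (hs : s < n), P'.ctrl ⟨i, hi⟩ ⟨s, hs⟩) ∨
      k = 2 ∧ P'.PathEnd s ∨ k = 3 ∧ P'.PathTable l i s
  have hn : n < (P.encode e).length := by rw [P.length_encode]; omega
  have hE : ∀ s t, P'.Edge s t → P.Edge s t := fun s t => Or.imp (hctrl s t) (hunctrl s t).mp
  have hC : ∀ s t : Fin n, certBit c n 1 0 s t ↔ P'.ctrl s t := fun s t => by
    rw [hQ 1 (by omega) 0 (by omega) s (by omega) t (by omega)]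
    simp
  have hP' : P'.DescribedBy (initBit m (P.encode e) n) (certBit c n 1 0)
      (unctrlBit m (P.encode e) n) fun s a => labelBit m (P.encode e) n s (e.symm a) :=
    ⟨by rw [hinit]; exact hP.init, hC, fun s t => (hP.unctrl s t).trans (hunctrl s t).symm,
      fun s a => by rw [hlabel]; exact hP.label s a⟩
  have hR := (hP'.isPathTable hTS hE).congr (V' := certBit c n 2 0 0) (R' := certBit c n 3)
    (fun l hl => by
      rw [hQ 2 (by omega) 0 (by omega) 0 (by omega) l (by omega)]
      simp)
    (fun l hl i hi s hs => by
      rw [hQ 3 (by omega) l (by omega) i (by omega) s (by omega)]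
      simp)
  refine ⟨c, ?_, n, hn, P.isPlantWord_encode e, hO.congr fun s hs t ht => ?_,
    ⟨fun s hs t ht hst => ?_, fun s hs => ?_⟩, hR, ?_⟩
  · rw [hc]
    exact Nat.pow_le_pow_left (by omega) 4
  · rw [hQ 0 (by omega) 0 (by omega) s (by omega) t (by omega)]
    simp
  · exact (hP.ctrl ⟨s, hs⟩ ⟨t, ht⟩).mpr (hctrl _ _ ((hC ⟨s, hs⟩ ⟨t, ht⟩).mp hst))
  · obtain ⟨t, ht⟩ := P'.total ⟨s, hs⟩
    exact ⟨t, t.2, (hP'.step ⟨s, hs⟩ t).mpr ht⟩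
  · exact (hP'.models_iff
      (fun s t hs hst => hTS.eq_of_selfLoop (hE _ _ hs) (hE _ _ hst)) hR φ).mp hφ

/-- For every finite set of atomic propositions and every closed HyperLTL formula, controller
synthesis for tree-shaped plants is in NP in the size of the plant. -/
theorem theorem3 {AP : Type*} {m : ℕ} (e : Fin m ≃ AP) (φ : HyperLTL AP) (hφ : φ.Closed) :
    InNP (treeSynthesis e φ) := by
  classical
  refine ⟨fun x => decide (Verified e φ x), (Polynomial.X + 4) ^ 4, ?_, fun w => ⟨fun h => ?_, ?_⟩⟩
  · convert (fo_verified e φ).nonempty_polyTime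
  · obtain ⟨c, hc, hv⟩ := exists_verified e φ h
    exact ⟨c, by simpa using hc, decide_eq_true hv⟩
  · rintro ⟨c, -, hv⟩
    exact mem_treeSynthesis_of_verified e φ (of_decide_eq_true hv)
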